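/- **Setting.** Let $\mathcal U$ be a finite set of variables and $\mathcal F=\mathbb Z^{\mathcal U}$ the set of stores. A *distribution* is a map $D:\mathcal F\to[0,\infty)$ with finite total mass $\sum D:=\sum_{s}D(s)<\infty$. For $R\subseteq\mathcal U$ and $s:R\to\mathbb Z$ put $D(s)=\sum_{s_0\in\mathcal F,\ s_0|_R=s}D(s_0)$. Distributions $D_1,D_2$ *agree on* $R$ if $D_1(s)=D_2(s)$ for all $s:R\to\mathbb Z$. Disjoint sets $R_1,R_2\subseteq\mathcal U$ are *independent in* $D$ if $D(s_1\oplus s_2)\cdot\sum D=D(s_1)D(s_2)$ for all $s_1:R_1\to\mathbb Z$, $s_2:R_2\to\mathbb Z$, where $s_1\oplus s_2$ is the common extension to $R_1\cup R_2$. A *probabilistic control-flow graph* has a finite set $\mathcal V$ of nodes. Each node is labeled with an assignment $x:=E$, a random assignment $x:=\mathrm{random}(\psi)$ ($\psi$ a probability distribution on $\mathbb Z$), $\mathbf{Observe}(B)$ or $\mathbf{Skip}$, and then has exactly one outgoing edge; or it is a branching node with a condition $B$, a true-successor and a false-successor; or it is the unique node $\mathtt{End}$, which has no outgoing edge and may be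 labeled $\mathbf{Return}(x)$. (The value of an arithmetic or boolean expression depends only on its free variables.) Every node has a path to $\mathtt{End}$, and there is a node $\mathtt{Start}$ with a path to every node. $\mathrm{Def}(v)$ is the variable assigned at $v$, if any; $\mathrm{Use}(v)$ consists of the free variables of the expression or condition at $v$, and of $x$ if $v$ is labeled $\mathbf{Return}(x)$. On every path from $\mathtt{Start}$ to $v$ every $x\in\mathrm{Use}(v)$ is defined at some node different from $v$. $(v,v')\in\mathsf{PD}$ ($v'$ *postdominates* $v$) means that $v'$ lies on all paths from $v$ to $\mathtt{End}$. For $v\neq\mathtt{End}$, $\mathrm{fppd}(v)$ is the first proper postdominator: the $v_1\ne v$ postdominating $v$ that lies on all paths from $v$ to each other postdominator $v_2\neq v$ of $v$. $\mathrm{LAP}(v,v')$ is the maximal number of edges of an acyclic path from $v$ to $v'$. A node $v\ne\mathtt{End}$ is *cycle-inducing* if it has a successor $u$ with $\mathrm{LAP}(u,\mathrm{fppd}(v))\ge\mathrm{LAP}(v,\mathrm{fppd}(v))$. **Semantics.** For $X\subseteq\mathcal V$ and $h_0$ assigning to each pair in $\mathsf{PD}$ a map from weights to weights (weights being maps $\mathcal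 F\to[0,\infty]$), $h=H_X(h_0)$ is defined by recursion on $\mathrm{LAP}(v,v')$. (1) $h(v,v)(D)=D$. (2) If $v'\ne v$ and $v'\neq v'':=\mathrm{fppd}(v)$, then $h(v,v')(D)=h(v'',v')(h(v,v'')(D))$. (3) If $v'\neq v$ and $v'=\mathrm{fppd}(v)$: $h(v,v')(D)=D$ if $v\notin X$ or $v$ is a $\mathbf{Skip}$ node; otherwise, for $x:=E$ it is $s'\mapsto\sum_{s:\,s'=s[x\mapsto E(s)]}D(s)$; for $x:=\mathrm{random}(\psi)$ it is $s'\mapsto\sum_{s:\,s=s'\text{ off }x}\psi(s'(x))D(s)$; for $\mathbf{Observe}(B)$ it is $\mathrm{select}_B(D)$, which keeps $D(s)$ where $B$ holds in $s$ and is $0$ elsewhere; for a branching node with condition $B$ and successors $v_1$ (true), $v_2$ (false) it is $D_1'+D_2'$, where, with $D_1=\mathrm{select}_B(D)$ and $D_2=\mathrm{select}_{\neg B}(D)$, $D_i'=h(v_i,v')(D_i)$ if $\mathrm{LAP}(v_i,v')<\mathrm{LAP}(v,v')$ and $D_i'=h_0(v_i,v')(D_i)$ otherwise. Let $\mathrm{fix}(H_X)=\lim_k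 H_X^k(0)$ (pointwise supremum), the least fixed point of $H_X$ among families of continuous maps. Put $\omega=\mathrm{fix}(H_{\mathcal V})$, the meaning of the original program. **Slicing pairs.** Node $v_2$ is *data dependent* on $v_1$ if there are $x\in\mathrm{Use}(v_2)\cap\mathrm{Def}(v_1)$ and a path with at least one edge from $v_1$ to $v_2$ with no interior node defining $x$. A *next visible* in $Q\subseteq\mathcal V$ of $v$ is a node $v'\in Q\cup\{\mathtt{End}\}$ that lies on all paths from $v$ to nodes of $Q\cup\{\mathtt{End}\}$. $Q$ is a *weak slice set* if every node has a next visible in $Q$, and $v_1\in Q$ whenever some $v_2\in Q$ is data dependent on $v_1$. $(Q,Q_0)$ is a *slicing pair* if $Q,Q_0$ are disjoint weak slice sets, $\mathtt{End}\in Q$, all $\mathbf{Observe}$ nodes are in $Q\cup Q_0$, and every cycle-inducing node $v$ is in $Q\cup Q_0$ or satisfies $\sum\omega(v,\mathrm{fppd}(v))(D)=\sum D$ for all distributions $D$. The set $\mathrm{rv}_Q(v)$ of $Q$-*relevant variables* consists of the $x$ for which there are $v'\in Q$ with $x\in\mathrm{Use}(v')$ and an acyclic path from $v$ to $v'$ on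 which no node other than $v'$ defines $x$. For $(v,v')\in\mathsf{PD}$, $v$ *stays outside* $Q_0$ *until* $v'$ if every path from $v$ to $v'$ on which $v'$ occurs only at the end contains no node of $Q_0$ except possibly $v'$. **Theorem.** Given a probabilistic control-flow graph, let $(Q,Q_0)$ be a slicing pair and let $\phi=\mathrm{fix}(H_Q)$ be the meaning of the sliced program. For every $(v,v')\in\mathsf{PD}$ and every distribution $D$ such that $\mathrm{rv}_Q(v)$ and $\mathrm{rv}_{Q_0}(v)$ are independent in $D$, there is a real number $c$ with $0\le c\le 1$ such that $\omega(v,v')(D)$ agrees with $c\cdot\phi(v,v')(D)$ on $\mathrm{rv}_Q(v')$; moreover, if $v$ stays outside $Q_0$ until $v'$, then this holds with $c=1$. -/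

import Mathlib

open scoped ENNReal NNReal

/-! ### Stores, expressions and distributions -/

/-- Total stores over the universe `U` of variables. -/
abbrev Store (U : Type*) := U → ℤ

/-- Partial stores with domain exactly `R`. -/
abbrev StoreOn {U : Type*} (R : Set U) := R → ℤ

/-- An expression with values in `α`: a set of free variables together with its value as a function
of a store whose domain is that set. Arithmetic expressions are the case `α = ℤ`, boolean
expressions the case `α = Bool`. -/
structure Expr (U : Type*) (α : Type*) where
  fv : Set U
  eval : StoreOn fv → α

/-- The value of an expression in a total store. -/
def Expr.value {U α : Type*} (E : Expr U α) (s : Store U) : α := E.eval fun x => s x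

/-- Non-negative weights on stores. The value `∞` is admitted so that suprema of chains and
arbitrary sums exist; the distributions proper are the weights of finite total mass
(`IsDistribution`). -/
abbrev Weight (U : Type*) := Store U → ℝ≥0∞

namespace Weight

variable {U : Type*}

/-- The total mass `∑ D`. -/
noncomputable def mass (D : Weight U) : ℝ≥0∞ := ∑' s, D s

/-- `D` is a distribution: its total mass is finite, hence so are all its values. -/
def IsDistribution (D : Weight U) : Prop := D.mass ≠ ∞

open Classical in
/-- `D(s)` for a partial store `s`: the sum of the weights of the total stores agreeing with `s`
on its domain `R`. -/
noncomputable def marginal (D : Weight U) {R : Set U} (s : StoreOn R) : ℝ≥0∞ :=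
  ∑' s₀ : Store U, if ∀ x : R, s₀ x = s x then D s₀ else 0

/-- `D₁` agrees with `D₂` on `R`. -/
def AgreeOn (D₁ D₂ : Weight U) (R : Set U) : Prop :=
  ∀ s : StoreOn R, D₁.marginal s = D₂.marginal s

open Classical in
/-- The union `s₁ ⊕ s₂` of two partial stores (used for disjoint domains only). -/
noncomputable def joinStore {R₁ R₂ : Set U} (s₁ : StoreOn R₁) (s₂ : StoreOn R₂) :
    StoreOn (R₁ ∪ R₂) := fun x =>
  if h : (x : U) ∈ R₁ then s₁ ⟨x, h⟩ else s₂ ⟨x, x.2.resolve_left h⟩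

/-- Independence in `D` of two (disjoint) sets of variables. -/
def Independent (D : Weight U) (R₁ R₂ : Set U) : Prop :=
  ∀ (s₁ : StoreOn R₁) (s₂ : StoreOn R₂),
    D.marginal (joinStore s₁ s₂) * D.mass = D.marginal s₁ * D.marginal s₂

/-- The transfer function for selecting the stores in which `B` has truth value `b`;
`b = false` is selection by the negation of `B`. -/
noncomputable def select (B : Expr U Bool) (b : Bool) (D : Weight U) : Weight U :=
  fun s => if B.value s = b then D s else 0

open Classical in
/-- The transfer function of an assignment `x := E`. -/
noncomputable def assign (x : U) (E : Expr U ℤ) (D : Weight U) : Weight U :=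
  fun s' => ∑' s : Store U, if s' = Function.update s x (E.value s) then D s else 0

open Classical in
/-- The transfer function of a random assignment `x := random ψ`. -/
noncomputable def randAssign (x : U) (ψ : PMF ℤ) (D : Weight U) : Weight U :=
  fun s' => ∑' s : Store U, if ∀ y, y ≠ x → s' y = s y then ψ (s' x) * D s else 0

/-- `f` preserves the total mass of every distribution. -/
def SumPreserving (f : Weight U → Weight U) : Prop :=
  ∀ D : Weight U, D.IsDistribution → (f D).mass = D.mass

/-- Continuity: monotonicity together with preservation of suprema of chains. -/
def ChainContinuous (f : Weight U → Weight U) : Prop :=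
  Monotone f ∧ ∀ D : ℕ → Weight U, Monotone D → f (⨆ k, D k) = ⨆ k, f (D k)

end Weight

/-! ### Probabilistic control-flow graphs -/

/-- The label of a node together with its outgoing edges. `halt r` is the label of the end node,
with `r = some x` for `Return x`. -/
inductive Instr (U V : Type*) where
  | skip (next : V)
  | assign (x : U) (E : Expr U ℤ) (next : V)
  | randAssign (x : U) (ψ : PMF ℤ) (next : V)
  | observe (B : Expr U Bool) (next : V)
  | branch (B : Expr U Bool) (onTrue onFalse : V)
  | halt (r : Option U)

namespace Instr

variable {U V : Type*}

/-- The set of successors. -/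
def succs : Instr U V → Set V
  | skip n => {n}
  | assign _ _ n => {n}
  | randAssign _ _ n => {n}
  | observe _ n => {n}
  | branch _ t f => {t, f}
  | halt _ => ∅

/-- The set of variables defined. -/
def defs : Instr U V → Set U
  | assign x _ _ => {x}
  | randAssign x _ _ => {x}
  | _ => ∅

/-- The set of variables used. -/
def uses : Instr U V → Set U
  | assign _ E _ => E.fv
  | observe B _ => B.fv
  | branch B _ _ => B.fv
  | halt (some x) => {x}
  | _ => ∅

/-- Being an `Observe` node. -/
def IsObserve : Instr U V → Prop
  | observe _ _ => True
  | _ => False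

/-- Being the label of an end node. -/
def IsHalt : Instr U V → Prop
  | halt _ => True
  | _ => False

end Instr

/-- `IsPathIn code v π w`: the list `π` of nodes is a path from `v` to `w`, both included. -/
inductive IsPathIn {U V : Type*} (code : V → Instr U V) : V → List V → V → Prop
  | single (v : V) : IsPathIn code v [v] v
  | cons {v u w : V} {π : List V} (hvu : u ∈ (code v).succs) (hπ : IsPathIn code u π w) :
      IsPathIn code v (v :: π) w

/-- A probabilistic control-flow graph with variables in `U` and nodes in `V`. -/
structure PCFG (U V : Type*) where
  code : V → Instr U V
  start : V
  finish : V
  isHalt_iff : ∀ v, (code v).IsHalt ↔ v = finish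
  exists_path_finish : ∀ v, ∃ π, IsPathIn code v π finish
  exists_path_start : ∀ v, ∃ π, IsPathIn code start π v
  defined_before_use : ∀ v, ∀ x ∈ (code v).uses, ∀ π, IsPathIn code start π v →
    ∃ v₀ ∈ π, v₀ ≠ v ∧ x ∈ (code v₀).defs

namespace PCFG

variable {U V : Type*} (G : PCFG U V)

/-- `π` is a path from `v` to `w`. -/
abbrev IsPath (v : V) (π : List V) (w : V) : Prop := IsPathIn G.code v π w

/-- `w` postdominates `v`, that is `(v, w) ∈ PD`. -/
def Postdom (v w : V) : Prop := ∀ π, G.IsPath v π G.finish → w ∈ π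

/-- The set `PD`. -/
abbrev PD := {p : V × V // G.Postdom p.1 p.2}

/-- `w` is the first proper postdominator of `v`. -/
def IsFirstProperPostdom (v w : V) : Prop :=
  (G.Postdom v w ∧ w ≠ v) ∧
    ∀ u, G.Postdom v u → u ≠ v → ∀ π, G.IsPath v π u → w ∈ π

open Classical in
/-- The first proper postdominator of `v`; it exists whenever `v` is not the end node
(`fppd_spec`), and the end node, which has none, is sent to itself. -/
noncomputable def fppd (v : V) : V :=
  if h : ∃ w, G.IsFirstProperPostdom v w then h.choose else v

/-- The maximum length (number of edges) of an acyclic path from `v` to `w`. -/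
noncomputable def LAP (v w : V) : ℕ :=
  sSup {n | ∃ π, G.IsPath v π w ∧ π.Nodup ∧ π.length = n + 1}

/-! #### Facts that make the semantics well-defined -/

section Facts

variable {G}

theorem IsPath.append {v u w : V} {π ρ : List V} (h : G.IsPath v π u)
    (h' : G.IsPath u (u :: ρ) w) : G.IsPath v (π ++ ρ) w := by
  induction h with
  | single v => simpa using h'
  | cons hvu _ ih => exact .cons hvu (ih h')

theorem IsPath.head {v w : V} {π : List V} (h : G.IsPath v π w) : ∃ ρ, π = v :: ρ := by
  cases h with
  | single => exact ⟨[], rfl⟩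
  | cons _ _ => exact ⟨_, rfl⟩

theorem IsPath.last {v w : V} {π : List V} (h : G.IsPath v π w) : ∃ ρ, π = ρ ++ [w] := by
  induction h with
  | single v => exact ⟨[], rfl⟩
  | @cons v _ _ _ _ _ ih =>
    obtain ⟨ρ, rfl⟩ := ih
    exact ⟨v :: ρ, rfl⟩

theorem IsPath.split {v u w : V} {a b : List V} (h : G.IsPath v (a ++ u :: b) w) :
    G.IsPath v (a ++ [u]) u ∧ G.IsPath u (u :: b) w := by
  induction a generalizing v with
  | nil =>
    obtain ⟨ρ, hρ⟩ := h.head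
    obtain rfl : u = v := by simpa using congrArg List.head? hρ
    exact ⟨.single _, h⟩
  | cons c a ih =>
    rw [List.cons_append] at h
    generalize hl : a ++ u :: b = l at h
    cases h with
    | single => simp at hl
    | cons hvu hπ =>
      rw [← hl] at hπ
      exact ⟨.cons hvu (ih hπ).1, (ih hπ).2⟩

theorem IsPath.exists_nodup {v w : V} {π : List V} (h : G.IsPath v π w) :
    ∃ ρ, G.IsPath v ρ w ∧ ρ.Nodup := by
  induction h with
  | single v => exact ⟨[v], .single v, by simp⟩
  | @cons v u w π hvu _ ih =>
    obtain ⟨ρ, hρ, hn⟩ := ih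
    by_cases hv : v ∈ ρ
    · obtain ⟨a, b, rfl⟩ := List.append_of_mem hv
      exact ⟨v :: b, (IsPath.split hρ).2, (List.nodup_append.1 hn).2.1⟩
    · exact ⟨v :: ρ, .cons hvu hρ, List.nodup_cons.2 ⟨hv, hn⟩⟩

theorem exists_nodup_finish (v : V) : ∃ ρ, G.IsPath v (v :: ρ) G.finish ∧ (v :: ρ).Nodup := by
  obtain ⟨π, hπ⟩ := G.exists_path_finish v
  obtain ⟨ρ, hρ, hn⟩ := IsPath.exists_nodup hπ
  obtain ⟨σ, rfl⟩ := hρ.head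
  exact ⟨σ, hρ, hn⟩

theorem Postdom.exists_nodup {v w : V} (h : G.Postdom v w) :
    ∃ ρ, G.IsPath v ρ w ∧ ρ.Nodup := by
  obtain ⟨π, hπ⟩ := G.exists_path_finish v
  obtain ⟨a, b, rfl⟩ := List.append_of_mem (h π hπ)
  exact IsPath.exists_nodup (IsPath.split hπ).1

theorem succs_finish : (G.code G.finish).succs = ∅ := by
  have h := (G.isHalt_iff G.finish).2 rfl
  generalize G.code G.finish = c at h
  cases c <;> simp_all [Instr.IsHalt, Instr.succs]

theorem eq_finish_of_postdom {w : V} (h : G.Postdom G.finish w) : w = G.finish := by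
  simpa using h [G.finish] (.single _)

theorem exists_isFirstProperPostdom {v : V} (hv : v ≠ G.finish) :
    ∃ w, G.IsFirstProperPostdom v w := by
  classical
  have hfin : G.Postdom v G.finish := fun π hπ => by
    obtain ⟨ρ, rfl⟩ := hπ.last
    simp
  have hex : ∃ n, ∃ w π, G.Postdom v w ∧ w ≠ v ∧ G.IsPath v π w ∧ π.length = n := by
    obtain ⟨π, hπ⟩ := G.exists_path_finish v
    exact ⟨_, _, π, hfin, hv.symm, hπ, rfl⟩
  obtain ⟨w, π, hw, hwv, hπ, hlen⟩ := Nat.find_spec hex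
  have hmin := fun m (hm : m < π.length) => Nat.find_min hex (hlen ▸ hm)
  refine ⟨w, ⟨hw, hwv⟩, fun u hu huv ρ hρ => ?_⟩
  by_contra hwρ
  have huw : u ≠ w := by
    rintro rfl
    obtain ⟨σ, rfl⟩ := hρ.last
    simp at hwρ
  obtain ⟨σ, hσ, hσn⟩ := exists_nodup_finish (G := G) w
  rcases List.mem_append.1 (hu _ (IsPath.append hπ hσ)) with h | h
  · obtain ⟨a, b, rfl⟩ := List.append_of_mem h
    refine hmin (a ++ [u]).length ?_ ⟨u, _, hu, huv, (IsPath.split hπ).1, rfl⟩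
    have hb : b ≠ [] := by
      rintro rfl
      obtain ⟨τ, hτ⟩ := hπ.last
      have := (List.append_inj' hτ rfl).2
      exact huw (by simpa using this)
    have := List.length_pos_iff.2 hb
    simp
    omega
  · obtain ⟨a, b, rfl⟩ := List.append_of_mem h
    have h1 := (IsPath.split (a := w :: a) hσ).2
    have := hw _ (IsPath.append hρ h1)
    simp_all

theorem fppd_spec {v : V} (hv : v ≠ G.finish) : G.IsFirstProperPostdom v (G.fppd v) := by
  have h := exists_isFirstProperPostdom hv
  rw [fppd, dif_pos h]
  exact h.choose_spec

theorem postdom_fppd (v : V) : G.Postdom v (G.fppd v) := by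
  unfold fppd
  split_ifs with h
  · exact h.choose_spec.1.1
  · intro π hπ
    obtain ⟨ρ, rfl⟩ := hπ.head
    simp

theorem ne_finish_of_postdom {v w : V} (h : G.Postdom v w) (hne : w ≠ v) : v ≠ G.finish := by
  rintro rfl
  exact hne (eq_finish_of_postdom h)

theorem postdom_fppd_left {v w : V} (h : G.Postdom v w) (hne : w ≠ v) (hf : w ≠ G.fppd v) :
    G.Postdom (G.fppd v) w := by
  intro τ hτ
  have hF := fppd_spec (ne_finish_of_postdom h hne)
  obtain ⟨π, hπ, hn⟩ := h.exists_nodup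
  obtain ⟨a, b, rfl⟩ := List.append_of_mem (hF.2 w h hne π hπ)
  have h1 := (IsPath.split hπ).1
  obtain ⟨σ, rfl⟩ := hτ.head
  have hwb : w ∈ b := by
    obtain ⟨ρ, hρ⟩ := (IsPath.split hπ).2.last
    have : w ∈ G.fppd v :: b := by rw [hρ]; simp
    simpa [hf] using this
  have hwa : w ∉ a := by
    intro hwa
    exact (List.nodup_append.1 hn).2.2 w hwa w (by simp [hwb]) rfl
  have := h _ (IsPath.append h1 hτ)
  simp_all

theorem postdom_succ {v u w : V} (h : G.Postdom v w) (hne : w ≠ v)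
    (hu : u ∈ (G.code v).succs) : G.Postdom u w := by
  intro π hπ
  have := h _ (.cons hu hπ)
  simpa [hne] using this

variable [Finite V]

theorem LAP_bddAbove (v w : V) :
    BddAbove {n | ∃ π, G.IsPath v π w ∧ π.Nodup ∧ π.length = n + 1} := by
  have := Fintype.ofFinite V
  refine ⟨Fintype.card V, ?_⟩
  rintro n ⟨π, -, hn, hl⟩
  have := hn.length_le_card
  omega

theorem le_LAP {v w : V} {π : List V} (h : G.IsPath v π w) (hn : π.Nodup) :
    π.length ≤ G.LAP v w + 1 := by
  obtain ⟨ρ, rfl⟩ := h.head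
  have := le_csSup (LAP_bddAbove v w) ⟨_, h, hn, List.length_cons⟩
  simpa [LAP] using this

theorem Postdom.exists_LAP {v w : V} (h : G.Postdom v w) :
    ∃ π, G.IsPath v π w ∧ π.Nodup ∧ π.length = G.LAP v w + 1 := by
  obtain ⟨ρ, hρ, hn⟩ := h.exists_nodup
  obtain ⟨σ, rfl⟩ := hρ.head
  exact Nat.sSup_mem (s := {n | ∃ π, G.IsPath v π w ∧ π.Nodup ∧ π.length = n + 1})
    ⟨_, _, hρ, hn, List.length_cons⟩ (LAP_bddAbove v w)

theorem LAP_pos {v w : V} (h : G.Postdom v w) (hne : w ≠ v) : 0 < G.LAP v w := by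
  obtain ⟨π, hπ, -, hl⟩ := h.exists_LAP
  cases hπ with
  | single => exact absurd rfl hne
  | cons _ hπ =>
    obtain ⟨ρ, rfl⟩ := IsPath.head hπ
    simp at hl
    omega

theorem LAP_fppd_add {v w : V} (h : G.Postdom v w) (hne : w ≠ v) (hf : w ≠ G.fppd v) :
    G.LAP v (G.fppd v) + G.LAP (G.fppd v) w ≤ G.LAP v w := by
  have h1 := postdom_fppd (G := G) v
  have h2 := postdom_fppd_left h hne hf
  obtain ⟨π, hπ, hπn, hπl⟩ := h1.exists_LAP
  obtain ⟨ρ, hρ, hρn, hρl⟩ := h2.exists_LAP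
  obtain ⟨ρ, rfl⟩ := hρ.head
  have hn : (π ++ ρ).Nodup := by
    refine List.nodup_append.2 ⟨hπn, (List.nodup_cons.1 hρn).2, ?_⟩
    rintro u hu _ hu' rfl
    obtain ⟨a, b, rfl⟩ := List.append_of_mem hu
    obtain ⟨c, d, rfl⟩ := List.append_of_mem hu'
    obtain ⟨σ, hσ, hσn⟩ := exists_nodup_finish (G := G) (G.fppd v)
    have hwσ : w ∈ σ := by simpa [hf] using h2 _ hσ
    obtain ⟨e, f, rfl⟩ := List.append_of_mem hwσ
    have p1 := (IsPath.split hπ).1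
    have p2 := (IsPath.split (a := G.fppd v :: c) hρ).2
    have p3 := (IsPath.split (a := G.fppd v :: e) hσ).2
    have hb : G.fppd v ∈ b := by
      obtain ⟨τ, hτ⟩ := (IsPath.split hπ).2.last
      have : G.fppd v ∈ u :: b := by rw [hτ]; simp
      have hne : G.fppd v ≠ u := by
        rintro h
        rw [← h] at hρn
        simp at hρn
      simpa [hne] using this
    have := h1 _ (IsPath.append (IsPath.append p1 p2) p3)
    have ha : G.fppd v ∉ a := fun ha =>
      (List.nodup_append.1 hπn).2.2 _ ha (G.fppd v) (by simp [hb]) rfl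
    simp_all
  have := le_LAP (IsPath.append hπ hρ) hn
  simp at this hρl
  omega

theorem LAP_fppd_lt {v w : V} (h : G.Postdom v w) (hne : w ≠ v) (hf : w ≠ G.fppd v) :
    G.LAP v (G.fppd v) < G.LAP v w := by
  have := LAP_fppd_add h hne hf
  have := LAP_pos (postdom_fppd_left h hne hf) hf
  omega

theorem LAP_fppd_left_lt {v w : V} (h : G.Postdom v w) (hne : w ≠ v) (hf : w ≠ G.fppd v) :
    G.LAP (G.fppd v) w < G.LAP v w := by
  have := LAP_fppd_add h hne hf
  have := LAP_pos (postdom_fppd v) (fppd_spec (ne_finish_of_postdom h hne)).1.2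
  omega

end Facts

/-! #### Fixed-point semantics -/

/-- Modification functions. -/
abbrev ModFun := G.PD → Weight U → Weight U

open Classical in
/-- The value at `(v, v')` of the functional that takes into account the nodes in `X` only,
by recursion on `LAP v v'`. -/
noncomputable def step [Finite V] (X : Set V) (h₀ : G.ModFun) (v v' : V) (hp : G.Postdom v v')
    (D : Weight U) : Weight U :=
  if h1 : v' = v then D
  else if h2 : v' ≠ G.fppd v then
    step X h₀ (G.fppd v) v' (postdom_fppd_left hp h1 h2)
      (step X h₀ v (G.fppd v) (postdom_fppd v) D)
  else if v ∉ X then D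
  else
    match hc : G.code v with
    | .skip _ => D
    | .assign x E _ => D.assign x E
    | .randAssign x ψ _ => D.randAssign x ψ
    | .observe B _ => D.select B true
    | .branch B t f =>
      have ht : G.Postdom t v' := postdom_succ hp h1 (by simp [hc, Instr.succs])
      have hf : G.Postdom f v' := postdom_succ hp h1 (by simp [hc, Instr.succs])
      (if _hlt : G.LAP t v' < G.LAP v v' then step X h₀ t v' ht (D.select B true)
        else h₀ ⟨(t, v'), ht⟩ (D.select B true)) +
      (if _hlt : G.LAP f v' < G.LAP v v' then step X h₀ f v' hf (D.select B false)
        else h₀ ⟨(f, v'), hf⟩ (D.select B false))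
    | .halt _ => D -- impossible, since `v` is not the end node here
  termination_by G.LAP v v'
  decreasing_by
    · exact LAP_fppd_lt hp h1 h2
    · exact LAP_fppd_left_lt hp h1 h2
    · exact _hlt
    · exact _hlt

/-- The functional `H_X`. -/
noncomputable def HH [Finite V] (X : Set V) (h₀ : G.ModFun) : G.ModFun :=
  fun p => G.step X h₀ p.1.1 p.1.2 p.2

/-- `fix(H_X)`: the limit of the chain of the iterates of `H_X` from `0`; see `isLeast_fix`. -/
noncomputable def fix [Finite V] (X : Set V) : G.ModFun := ⨆ k : ℕ, (G.HH X)^[k] 0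

/-! #### `fix(H_X)` is the least fixed point among the continuous modification functions -/

section FixedPoint

theorem tsum_iSup_chain {ι : Type*} {g : ℕ → ι → ℝ≥0∞} (hg : Monotone g) :
    ∑' i, ⨆ k, g k i = ⨆ k, ∑' i, g k i := by
  let _ : MeasurableSpace ι := ⊤
  have h := MeasureTheory.lintegral_iSup (μ := MeasureTheory.Measure.count) (f := g)
    (fun n => measurable_from_top) hg
  simpa [MeasureTheory.lintegral_count] using h

open Classical in
theorem kernel_continuous (P : Store U → Store U → Prop) (c : Store U → Store U → ℝ≥0∞) :
    Weight.ChainContinuous (U := U)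
      (fun D s' => ∑' s, if P s' s then c s' s * D s else 0) := by
  have hm : ∀ s', Monotone fun (D : Weight U) s => if P s' s then c s' s * D s else 0 := by
    intro s' D₁ D₂ h s
    dsimp only
    split_ifs
    · exact mul_le_mul_right (h s) _
    · exact le_rfl
  refine ⟨fun D₁ D₂ h s' => ENNReal.tsum_le_tsum (hm s' h), fun D hD => ?_⟩
  funext s'
  rw [iSup_apply]
  refine Eq.trans ?_ (tsum_iSup_chain ((hm s').comp hD))
  refine tsum_congr fun s => ?_
  by_cases hP : P s' s <;> simp [hP, iSup_apply, ENNReal.mul_iSup]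

open Classical in
theorem assign_continuous (x : U) (E : Expr U ℤ) :
    Weight.ChainContinuous (Weight.assign x E) := by
  have h := kernel_continuous (U := U)
    (fun s' s => s' = Function.update s x (E.value s)) fun _ _ => 1
  simp only [one_mul] at h
  exact h

theorem randAssign_continuous (x : U) (ψ : PMF ℤ) :
    Weight.ChainContinuous (Weight.randAssign x ψ) :=
  kernel_continuous (U := U) (fun s' s => ∀ y, y ≠ x → s' y = s y) fun s' _ => ψ (s' x)

theorem select_continuous (B : Expr U Bool) (b : Bool) :
    Weight.ChainContinuous (Weight.select B b) := by
  refine ⟨fun D₁ D₂ h s => ?_, fun D _ => ?_⟩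
  · simp only [Weight.select]
    split_ifs
    · exact h s
    · exact le_rfl
  · funext s
    by_cases hB : B.value s = b <;> simp [Weight.select, hB, iSup_apply]

variable {G}

theorem call_iSup {h : ℕ → G.ModFun} (hh : Monotone h)
    (hc : ∀ k p, Weight.ChainContinuous (h k p)) (p : G.PD) {D : ℕ → Weight U}
    (hD : Monotone D) : (⨆ k, h k) p (⨆ k, D k) = ⨆ k, h k p (D k) := by
  simp only [iSup_apply, (hc _ p).2 D hD]
  refine le_antisymm (iSup_le fun i => iSup_le fun j => ?_) (iSup_le fun k => ?_)
  · exact ((hh (le_max_left i j) p (D j)).trans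
      ((hc _ p).1 (hD (le_max_right i j)))).trans (le_iSup (fun k => h k p (D k)) (max i j))
  · exact (le_iSup (fun j => h k p (D j)) k).trans (le_iSup (fun i => ⨆ j, h i p (D j)) k)

variable [Finite V]

theorem step_mono (X : Set V) {h h' : G.ModFun} (hh : h ≤ h') (hm : ∀ p, Monotone (h' p))
    (v v' : V) (hp : G.Postdom v v') {D D' : Weight U} (hD : D ≤ D') :
    G.step X h v v' hp D ≤ G.step X h' v v' hp D' := by
  induction hn : G.LAP v v' using Nat.strong_induction_on generalizing v v' D D' with
  | _ n ih =>
    subst hn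
    have hcall : ∀ p, ∀ {D D' : Weight U}, D ≤ D' → h p D ≤ h' p D' := fun p D D' hD =>
      (hh p D).trans (hm p hD)
    unfold step
    split_ifs with h1 h2
    · exact hD
    · exact ih _ (LAP_fppd_left_lt hp h1 h2) _ _ _
        (ih _ (LAP_fppd_lt hp h1 h2) _ _ _ hD rfl) rfl
    · split
      · exact hD
      · exact (assign_continuous _ _).1 hD
      · exact (randAssign_continuous _ _).1 hD
      · exact (select_continuous _ _).1 hD
      · refine add_le_add ?_ ?_
        · split_ifs with hlt
          · exact ih _ hlt _ _ _ ((select_continuous _ _).1 hD) rfl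
          · exact hcall _ ((select_continuous _ _).1 hD)
        · split_ifs with hlt
          · exact ih _ hlt _ _ _ ((select_continuous _ _).1 hD) rfl
          · exact hcall _ ((select_continuous _ _).1 hD)
      · exact hD
    · exact hD

theorem step_iSup (X : Set V) {h : ℕ → G.ModFun} (hh : Monotone h)
    (hc : ∀ k p, Weight.ChainContinuous (h k p)) (v v' : V) (hp : G.Postdom v v')
    {D : ℕ → Weight U} (hD : Monotone D) :
    G.step X (⨆ k, h k) v v' hp (⨆ k, D k) = ⨆ k, G.step X (h k) v v' hp (D k) := by
  induction hn : G.LAP v v' using Nat.strong_induction_on generalizing v v' D with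
  | _ n ih =>
    subst hn
    have hmono : ∀ v v' hp {D : ℕ → Weight U}, Monotone D →
        Monotone fun k => G.step X (h k) v v' hp (D k) := fun v v' hp D hD i j hij =>
      step_mono X (hh hij) (fun p => (hc j p).1) v v' hp (hD hij)
    unfold step
    split_ifs with h1 h2
    · rfl
    · rw [ih _ (LAP_fppd_lt hp h1 h2) _ _ _ hD rfl,
        ih _ (LAP_fppd_left_lt hp h1 h2) _ _ _ (hmono _ _ _ hD) rfl]
    · split
      · rfl
      · exact (assign_continuous _ _).2 D hD
      · exact (randAssign_continuous _ _).2 D hD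
      · exact (select_continuous _ _).2 D hD
      · rename_i B t f hcode
        have hadd : ∀ {F F' : ℕ → Weight U}, Monotone F → Monotone F' →
            (⨆ k, F k) + (⨆ k, F' k) = ⨆ k, F k + F' k := by
          intro F F' hF hF'
          funext s
          simp only [Pi.add_apply, iSup_apply]
          exact ENNReal.iSup_add_iSup_of_monotone (fun i j hij => hF hij s)
            (fun i j hij => hF' hij s)
        have hs : ∀ b, Monotone fun k => (D k).select B b := fun b i j hij =>
          (select_continuous B b).1 (hD hij)
        have key : ∀ (u : V) (hu : G.Postdom u v') (b : Bool),
            Monotone (fun k => if _hlt : G.LAP u v' < G.LAP v v' then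
              G.step X (h k) u v' hu ((D k).select B b) else h k ⟨(u, v'), hu⟩ ((D k).select B b)) ∧
            (if _hlt : G.LAP u v' < G.LAP v v' then
              G.step X (⨆ k, h k) u v' hu (Weight.select B b (⨆ k, D k))
              else (⨆ k, h k) ⟨(u, v'), hu⟩ (Weight.select B b (⨆ k, D k))) =
            ⨆ k, if _hlt : G.LAP u v' < G.LAP v v' then
              G.step X (h k) u v' hu ((D k).select B b)
              else h k ⟨(u, v'), hu⟩ ((D k).select B b) := by
          intro u hu b
          rw [(select_continuous B b).2 D hD]
          split_ifs with hlt
          · exact ⟨hmono _ _ _ (hs b), ih _ hlt _ _ _ (hs b) rfl⟩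
          · exact ⟨fun i j hij => (hh hij _ _).trans ((hc j _).1 (hs b hij)),
              call_iSup hh hc _ (hs b)⟩
        have ht : G.Postdom t v' := postdom_succ hp h1 (by simp [hcode, Instr.succs])
        have hf : G.Postdom f v' := postdom_succ hp h1 (by simp [hcode, Instr.succs])
        dsimp only
        rw [(key t ht true).2, (key f hf false).2, hadd (key t ht true).1 (key f hf false).1]
      · rfl
    · rfl

theorem HH_continuous (X : Set V) {h : G.ModFun} (hc : ∀ p, Weight.ChainContinuous (h p))
    (p : G.PD) : Weight.ChainContinuous (G.HH X h p) := by
  refine ⟨fun D D' hD => step_mono X le_rfl (fun p => (hc p).1) _ _ _ hD, fun D hD => ?_⟩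
  have := step_iSup X (h := fun _ => h) monotone_const (fun _ => hc) _ _ p.2 hD
  rwa [ciSup_const] at this

theorem iterate_continuous (X : Set V) (k : ℕ) (p : G.PD) :
    Weight.ChainContinuous ((G.HH X)^[k] 0 p) := by
  induction k generalizing p with
  | zero => exact ⟨fun _ _ _ => le_rfl, fun D _ => by simp⟩
  | succ k ih =>
    rw [Function.iterate_succ_apply']
    exact HH_continuous X ih p

theorem iterate_mono (X : Set V) : Monotone fun k => (G.HH X)^[k] 0 := by
  refine monotone_nat_of_le_succ fun k => ?_
  induction k with
  | zero => intro p D s; exact zero_le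
  | succ k ih =>
    simp only [Function.iterate_succ_apply'] at ih ⊢
    intro p D
    refine step_mono X ih (fun p => ?_) _ _ _ le_rfl
    exact (HH_continuous X (iterate_continuous X k) p).1

theorem isLeast_fix (X : Set V) :
    IsLeast {h : G.ModFun | (∀ p, Weight.ChainContinuous (h p)) ∧ G.HH X h = h} (G.fix X) := by
  refine ⟨⟨fun p => ⟨fun D D' hD => ?_, fun D hD => ?_⟩, ?_⟩, fun h ⟨hc, hfix⟩ => ?_⟩
  · simp only [fix, iSup_apply]
    exact iSup_mono fun k => (iterate_continuous X k p).1 hD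
  · simp only [fix, iSup_apply, (iterate_continuous X _ p).2 D hD]
    exact iSup_comm
  · funext p D
    have := step_iSup X (iterate_mono X) (iterate_continuous X) _ _ p.2
      (D := fun _ => D) monotone_const
    rw [ciSup_const] at this
    refine Eq.trans this ?_
    simp only [fix, iSup_apply]
    have h1 : ∀ k, G.step X ((G.HH X)^[k] 0) p.1.1 p.1.2 p.2 D = (G.HH X)^[k + 1] 0 p D :=
      fun k => by rw [Function.iterate_succ_apply']; rfl
    simp only [h1]
    exact (show Monotone fun k => (G.HH X)^[k] 0 p D from
      fun i j hij => iterate_mono X hij p D).iSup_nat_add 1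
  · refine iSup_le fun k => ?_
    induction k with
    | zero => intro p D s; exact zero_le
    | succ k ih =>
      rw [Function.iterate_succ_apply', ← hfix]
      intro p D
      exact step_mono X ih (fun p => (hc p).1) _ _ _ le_rfl

end FixedPoint

/-- The meaning of the original program. -/
noncomputable def omega [Finite V] : G.ModFun := G.fix Set.univ

/-! #### Dependence and slicing -/

/-- `v₂` is data dependent on `v₁`; the list `mid` holds the interior nodes of the path. -/
def DataDep (v₁ v₂ : V) : Prop :=
  ∃ x ∈ (G.code v₂).uses ∩ (G.code v₁).defs, ∃ mid : List V,
    G.IsPath v₁ (v₁ :: (mid ++ [v₂])) v₂ ∧ ∀ u ∈ mid, x ∉ (G.code u).defs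

/-- `Q` is closed under data dependence. -/
def DataClosed (Q : Set V) : Prop := ∀ v₁ v₂, v₂ ∈ Q → G.DataDep v₁ v₂ → v₁ ∈ Q

/-- The `Q`-relevant variables of `v`. -/
def rv (Q : Set V) (v : V) : Set U :=
  {x | ∃ v' ∈ Q, x ∈ (G.code v').uses ∧
    ∃ π, G.IsPath v π v' ∧ π.Nodup ∧ ∀ u ∈ π, u ≠ v' → x ∉ (G.code u).defs}

/-- `v` stays outside `Q` until `v'` (used for postdominators `v'` of `v` only). -/
def StaysOutside (v : V) (Q : Set V) (v' : V) : Prop :=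
  ∀ π, G.IsPath v π v' → v' ∉ π.dropLast → ∀ u ∈ π, u ∈ Q → u = v'

/-- `v` is cycle-inducing. -/
def CycleInducing (v : V) : Prop :=
  ∃ u ∈ (G.code v).succs, G.LAP v (G.fppd v) ≤ G.LAP u (G.fppd v)

/-- `v'` is a next visible in `Q` of `v`. -/
def NextVisible (Q : Set V) (v v' : V) : Prop :=
  v' ∈ Q ∪ {G.finish} ∧ ∀ u ∈ Q ∪ {G.finish}, ∀ π, G.IsPath v π u → v' ∈ π

/-- `Q` is a weak slice set: it provides next visibles and is closed under data dependence. -/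
def WeakSliceSet (Q : Set V) : Prop := (∀ v, ∃ v', G.NextVisible Q v v') ∧ G.DataClosed Q

/-- `(Q, Q₀)` is a slicing pair. -/
structure SlicingPair [Finite V] (Q Q₀ : Set V) : Prop where
  weak : G.WeakSliceSet Q
  weak₀ : G.WeakSliceSet Q₀
  finish_mem : G.finish ∈ Q
  disjoint : Disjoint Q Q₀
  observe_mem : ∀ v, (G.code v).IsObserve → v ∈ Q ∪ Q₀
  cycle : ∀ v, G.CycleInducing v →
    v ∈ Q ∪ Q₀ ∨ Weight.SumPreserving (G.omega ⟨(v, G.fppd v), postdom_fppd v⟩)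

end PCFG

namespace PCFG

variable {U V : Type*} {G : PCFG U V} {Q : Set V} {v v' u : V} {x : U}

/-! ### Graph-theoretic facts -/

/-! The argument is dual to the forward semantics. Each distribution transformer `h` has an adjoint
`w` on test functions, `∑ h(D)·F = ∑ D·w(F)`, and the adjoints satisfy the analogous recursion and
fixed-point equations (`dual_fix`, `WH_wfix`). The heart is `SlicingPair.factors`: if `f` depends
only on `rv_Q(v')` and `g` only on `rv_{Q₀}(v')`, then the adjoint of the original program sends
`f·g` to the product of the `Q`-slice adjoint of `f` and the `Q₀`-slice adjoint of `g`. Take for `f`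
the indicator of a partial store on `rv_Q(v')` and `g = 1`. The two factors depend on `rv_Q(v)` and
`rv_{Q₀}(v)` respectively, so independence, needed for the initial `D` only, splits the sum. This
gives `c = ∑ D·B / ∑ D`, where `B ≤ 1` is the image of `1` under the `Q₀`-slice adjoint; if `v`
stays outside `Q₀` until `v'`, then `B = 1`.

One application of the functional preserves factorization (`Factors.WH`): a node lies in at most one
of the slice sets, and outside a slice set it changes no relevant variable, while its branches
rejoin before that set is reached. The iterates from `0` do not factor, however, because a slice
skips at once a loop which the original program unrolls. The iterations therefore start higher, yet
below the fixed points: the slices start from the identity on pairs that avoid the slice set, the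
original program from its own limit on pairs that avoid both. There `wfix_frame` and the totality
result `SlicingPair.wfix_one` give factorization, and by `iSup_iterate_WH` the suprema are
unchanged. -/

theorem isPath_cut {w u : V} {π : List V} (h : G.IsPath v π w) (hu : u ∈ π) :
    ∃ ρ, G.IsPath v ρ u ∧ ρ ⊆ π := by
  obtain ⟨a, b, rfl⟩ := List.append_of_mem hu
  refine ⟨_, (IsPath.split h).1, fun y hy => ?_⟩
  simp only [List.mem_append, List.mem_cons, List.not_mem_nil, or_false] at hy ⊢
  tauto

theorem mem_of_isPath_left {w : V} {π : List V} (h : G.IsPath v π w) : v ∈ π := by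
  obtain ⟨ρ, rfl⟩ := h.head
  simp

theorem mem_of_isPath_right {w : V} {π : List V} (h : G.IsPath v π w) : w ∈ π := by
  obtain ⟨ρ, rfl⟩ := h.last
  simp

theorem isPath_trans {w : V} {π ρ : List V} (h : G.IsPath v π u) (h' : G.IsPath u ρ w) :
    ∃ σ, G.IsPath v σ w ∧ ∀ y, y ∈ σ ↔ y ∈ π ∨ y ∈ ρ := by
  obtain ⟨ρ, rfl⟩ := h'.head
  refine ⟨_, h.append h', fun y => ?_⟩
  have := mem_of_isPath_right h
  simp only [List.mem_append, List.mem_cons]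
  constructor
  · tauto
  · rintro (h | rfl | h) <;> tauto

/-- No node of `Q` can be reached from `v` without passing through `v'`. -/
def Avoids (G : PCFG U V) (v : V) (Q : Set V) (v' : V) : Prop :=
  ∀ π u, G.IsPath v π u → v' ∉ π → u ∉ Q

theorem Avoids.not_mem (h : G.Avoids v Q v') (hne : v' ≠ v) : v ∉ Q :=
  h [v] v (.single v) (by simpa using hne)

theorem Avoids.succ (h : G.Avoids v Q v') (hne : v' ≠ v) (hu : u ∈ (G.code v).succs) :
    G.Avoids u Q v' := fun π w hπ hv' =>
  h (v :: π) w (.cons hu hπ) (by simp [hne, hv'])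

theorem fppd_mem {w : V} {π : List V} (hp : G.Postdom v v') (hne : v' ≠ v)
    (hπ : G.IsPath v π w) (hw : v' ∈ π) : G.fppd v ∈ π := by
  obtain ⟨ρ, hρ, hs⟩ := isPath_cut hπ hw
  exact hs ((fppd_spec (ne_finish_of_postdom hp hne)).2 v' hp hne ρ hρ)

theorem Avoids.fppd (h : G.Avoids v Q v') (hp : G.Postdom v v') (hne : v' ≠ v) :
    G.Avoids v Q (G.fppd v) := fun π u hπ hf =>
  h π u hπ fun hv' => hf (fppd_mem hp hne hπ hv')

/-- An acyclic path works: if it met `v'`, then `G.fppd v` would already occur before `v'`, and once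
more at the end. -/
theorem exists_isPath_fppd_not_mem (hp : G.Postdom v v') (hne : v' ≠ v) (hf : v' ≠ G.fppd v) :
    ∃ π, G.IsPath v π (G.fppd v) ∧ v' ∉ π := by
  obtain ⟨π, hπ, hn⟩ := (postdom_fppd (G := G) v).exists_nodup
  refine ⟨π, hπ, fun hv' => ?_⟩
  obtain ⟨a, b, rfl⟩ := List.append_of_mem hv'
  have h1 := (fppd_spec (ne_finish_of_postdom hp hne)).2 v' hp hne _ (IsPath.split hπ).1
  have h2 := mem_of_isPath_right (IsPath.split hπ).2
  simp only [List.mem_append, List.mem_cons, List.not_mem_nil, or_false, hf.symm,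
    false_or] at h1 h2
  exact (List.nodup_append.1 hn).2.2 _ h1 (G.fppd v) (by simp [h2]) rfl

theorem Avoids.fppd_left (h : G.Avoids v Q v') (hp : G.Postdom v v') (hne : v' ≠ v)
    (hf : v' ≠ G.fppd v) : G.Avoids (G.fppd v) Q v' := by
  intro π u hπ hv'
  obtain ⟨ρ, hρ, hvρ⟩ := exists_isPath_fppd_not_mem hp hne hf
  obtain ⟨σ, hσ, hs⟩ := isPath_trans hρ hπ
  exact h σ u hσ (by simp [hs, hvρ, hv'])

/-- A path missing `v'` is prolonged by an acyclic path to the end node. The prolongation contains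
`v'` exactly once, and cutting there yields a path to which the hypothesis applies. -/
theorem StaysOutside.avoids (h : G.StaysOutside v Q v') (hp : G.Postdom v v') :
    G.Avoids v Q v' := by
  intro π u hπ hv' hu
  obtain ⟨ρ, hρ⟩ := exists_nodup_finish (G := G) u
  have hm := hp _ (IsPath.append hπ hρ.1)
  have hv : v' ∈ ρ := by simpa [hv'] using hm
  obtain ⟨a, b, hab⟩ := List.append_of_mem hv
  have h1 := IsPath.append hπ hρ.1
  rw [hab, ← List.append_assoc] at h1
  have h2 := (IsPath.split h1).1
  have h3 : v' ∉ a := by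
    intro ha
    have hn := (List.nodup_cons.1 hρ.2).2
    rw [hab] at hn
    exact (List.nodup_append.1 hn).2.2 v' ha v' (by simp) rfl
  have := h _ h2 (by simp [hv', h3]) u (by simp [mem_of_isPath_right hπ]) hu
  exact hv' (this ▸ mem_of_isPath_right hπ)

/-- The next visible of `v` differs from `v` and, the end node being visible, postdominates `v`;
hence every path that reaches it meets `G.fppd v`. -/
theorem WeakSliceSet.avoids_fppd (hQ : G.WeakSliceSet Q) (hv : v ∉ Q) (hne : v ≠ G.finish) :
    G.Avoids v Q (G.fppd v) := by
  intro π u hπ hf hu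
  obtain ⟨w, hw, hn⟩ := hQ.1 v
  have hwv : w ≠ v := by
    rintro rfl
    exact hw.elim hv hne
  have hp : G.Postdom v w := fun ρ hρ => hn _ (Or.inr rfl) ρ hρ
  exact hf (fppd_mem hp hwv hπ (hn u (Or.inl hu) π hπ))

/-! ### Relevant variables along paths. -/

theorem uses_subset_rv (hv : v ∈ Q) : (G.code v).uses ⊆ G.rv Q v := fun x hx =>
  ⟨v, hv, hx, [v], .single v, by simp, by simp⟩

theorem mem_rv_of_succ (hu : u ∈ (G.code v).succs) (hx : x ∈ G.rv Q u)
    (hd : x ∉ (G.code v).defs) : x ∈ G.rv Q v := by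
  obtain ⟨q, hq, hxq, π, hπ, hn, hc⟩ := hx
  -- Relevance paths are acyclic, so if `v` is already on the path, its suffix from `v` is taken.
  by_cases hv : v ∈ π
  · obtain ⟨a, b, rfl⟩ := List.append_of_mem hv
    exact ⟨q, hq, hxq, v :: b, (IsPath.split hπ).2, (List.nodup_append.1 hn).2.1,
      fun y hy => hc y (List.mem_append_right _ hy)⟩
  · refine ⟨q, hq, hxq, v :: π, .cons hu hπ, List.nodup_cons.2 ⟨hv, hn⟩, fun y hy => ?_⟩
    rcases List.mem_cons.1 hy with rfl | hy
    · exact fun _ => hd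
    · exact hc y hy

theorem DataClosed.mem_of_mem_rv (hQ : G.DataClosed Q) (hu : u ∈ (G.code v).succs)
    (hx : x ∈ G.rv Q u) (hd : x ∈ (G.code v).defs) : v ∈ Q := by
  obtain ⟨q, hq, hxq, π, hπ, hn, hc⟩ := hx
  obtain ⟨ρ, rfl⟩ := hπ.last
  refine hQ v q hq ⟨x, ⟨hxq, hd⟩, ρ, .cons hu hπ, fun y hy => hc y (by simp [hy]) ?_⟩
  rintro rfl
  exact (List.nodup_append.1 hn).2.2 y hy y (by simp) rfl

/-- Relevance is carried backwards along the path: a node before `v'` that defined `x` would belong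
to `Q` by data closure, which avoidance forbids. -/
theorem Avoids.rv_subset_aux (hQ : G.DataClosed Q) (hx : x ∈ G.rv Q v') {π : List V}
    (hπ : G.IsPath v π v') (h : G.Avoids v Q v') :
    x ∈ G.rv Q v ∧ (v' ≠ v → x ∉ (G.code v).defs) := by
  induction hπ with
  | single v => exact ⟨hx, fun h => absurd rfl h⟩
  | @cons v u w π hu _ ih =>
    by_cases hne : w = v
    · exact ⟨hne ▸ hx, fun h => absurd hne h⟩
    have hxu := (ih hx (h.succ hne hu)).1
    have hd : x ∉ (G.code v).defs := fun hd => h.not_mem hne (hQ.mem_of_mem_rv hu hxu hd)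
    exact ⟨mem_rv_of_succ hu hxu hd, fun _ => hd⟩

theorem Avoids.rv_subset (h : G.Avoids v Q v') (hQ : G.DataClosed Q) (hp : G.Postdom v v') :
    G.rv Q v' ⊆ G.rv Q v := fun _ hx =>
  have ⟨_, hπ, _⟩ := hp.exists_nodup
  (h.rv_subset_aux hQ hx hπ).1

theorem Avoids.not_mem_defs (h : G.Avoids v Q v') (hQ : G.DataClosed Q) (hp : G.Postdom v v')
    (hne : v' ≠ v) (hd : x ∈ (G.code v).defs) : x ∉ G.rv Q v' := fun hx =>
  have ⟨_, hπ, _⟩ := hp.exists_nodup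
  (h.rv_subset_aux hQ hx hπ).2 hne hd

/-- The first proper postdominator of a node with a single successor is that successor. -/
theorem fppd_eq_of_succs {n : V} (hs : (G.code v).succs = {n}) : G.fppd v = n := by
  have hv : v ≠ G.finish := by
    rintro rfl
    rw [succs_finish] at hs
    exact Set.singleton_ne_empty n hs.symm
  have key : ∀ {w : V} {π : List V}, G.IsPath v π w → w ≠ v → n ∈ π := by
    intro w π hπ hw
    cases hπ with
    | single => exact absurd rfl hw
    | cons hu hπ =>
      rw [hs] at hu
      obtain rfl : _ = n := hu
      simp [mem_of_isPath_left hπ]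
  -- A node whose only successor is itself could never reach the end node.
  have hnv : n ≠ v := by
    rintro rfl
    obtain ⟨π, hπ, hn⟩ := exists_nodup_finish (G := G) n
    cases hπ with
    | single => exact hv rfl
    | cons hu hπ =>
      rw [hs] at hu
      obtain rfl : _ = n := hu
      exact (List.nodup_cons.1 hn).1 (mem_of_isPath_left hπ)
  have hpn : G.Postdom v n := fun π hπ => key hπ hv.symm
  obtain ⟨⟨_, h1⟩, h2⟩ := fppd_spec hv
  have := h2 n hpn hnv [v, n] (.cons (by simp [hs]) (.single n))
  simpa [h1] using this

/-- A definition of a variable relevant to both sets would lie in both `Q` and `Q₀`. So a common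
variable remains relevant all the way back to the start without being defined, although its use
requires an earlier definition. -/
theorem disjoint_rv {Q₀ : Set V} (hQ : G.DataClosed Q) (hQ₀ : G.DataClosed Q₀)
    (hd : Disjoint Q Q₀) (v : V) : Disjoint (G.rv Q v) (G.rv Q₀ v) := by
  refine Set.disjoint_left.2 fun x hx hx₀ => ?_
  have key : ∀ {w : V} {π : List V}, G.IsPath w π v →
      (x ∈ G.rv Q w ∧ x ∈ G.rv Q₀ w) ∧ ∀ y ∈ π, y ≠ v → x ∉ (G.code y).defs := by
    intro w π hπ
    induction hπ with
    | single v => exact ⟨⟨hx, hx₀⟩, by simp⟩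
    | @cons w u v π hu _ ih =>
      obtain ⟨⟨h1, h2⟩, h3⟩ := ih hx hx₀
      have hdef : x ∉ (G.code w).defs := fun hw =>
        Set.disjoint_left.1 hd (hQ.mem_of_mem_rv hu h1 hw) (hQ₀.mem_of_mem_rv hu h2 hw)
      refine ⟨⟨mem_rv_of_succ hu h1 hdef, mem_rv_of_succ hu h2 hdef⟩, fun y hy => ?_⟩
      rcases List.mem_cons.1 hy with rfl | hy
      · exact fun _ => hdef
      · exact h3 y hy
  obtain ⟨π, hπ⟩ := G.exists_path_start v
  obtain ⟨q, hq, hxq, ρ, hρ, hn, hc⟩ := hx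
  obtain ⟨σ, hσ, hs⟩ := isPath_trans hπ hρ
  obtain ⟨y, hy, hyq, hxy⟩ := G.defined_before_use q x hxq σ hσ
  rcases (hs y).1 hy with h | h
  · by_cases hyv : y = v
    · exact hc y (hyv ▸ mem_of_isPath_left hρ) hyq hxy
    · exact (key hπ).2 y h hyv hxy
  · exact hc y h hyq hxy

end PCFG

namespace PCFG

variable {U V : Type*} {G : PCFG U V} {v v' u : V} {x : U} {X : Set V}

/-! ### Backward semantics -/

open Classical in
/-- The transformer of test functions dual to `step`. -/
noncomputable def wstep [Finite V] (X : Set V) (w : G.ModFun) (v v' : V) (hp : G.Postdom v v')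
    (F : Weight U) : Weight U :=
  if h1 : v' = v then F
  else if h2 : v' ≠ G.fppd v then
    -- Test functions are pulled back, so the later segment acts first.
    wstep X w v (G.fppd v) (postdom_fppd v)
      (wstep X w (G.fppd v) v' (postdom_fppd_left hp h1 h2) F)
  else if v ∉ X then F
  else
    match hc : G.code v with
    | .skip _ => F
    | .assign x E _ => fun s => F (Function.update s x (E.value s))
    | .randAssign x ψ _ => fun s => ∑' n, ψ n * F (Function.update s x n)
    | .observe B _ => fun s => if B.value s = true then F s else 0
    | .branch B t f =>
      have ht : G.Postdom t v' := postdom_succ hp h1 (by simp [hc, Instr.succs])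
      have hf : G.Postdom f v' := postdom_succ hp h1 (by simp [hc, Instr.succs])
      fun s => if B.value s = true then
        (if _hlt : G.LAP t v' < G.LAP v v' then wstep X w t v' ht F else w ⟨(t, v'), ht⟩ F) s
      else
        (if _hlt : G.LAP f v' < G.LAP v v' then wstep X w f v' hf F else w ⟨(f, v'), hf⟩ F) s
    | .halt _ => F
  termination_by G.LAP v v'
  decreasing_by
    · exact LAP_fppd_left_lt hp h1 h2
    · exact LAP_fppd_lt hp h1 h2
    · exact _hlt
    · exact _hlt

open Classical in
/-- The transformer used by `wstep X w v v'` at the successor `u` of the branching node `v`. -/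
noncomputable def wcall [Finite V] (X : Set V) (w : G.ModFun) (v v' u : V) (hu : G.Postdom u v')
    (F : Weight U) : Weight U :=
  if G.LAP u v' < G.LAP v v' then wstep X w u v' hu F else w ⟨(u, v'), hu⟩ F

/-- The functional on transformers of test functions dual to `HH`. -/
noncomputable def WH [Finite V] (X : Set V) (w : G.ModFun) : G.ModFun :=
  fun p => wstep X w p.1.1 p.1.2 p.2

/-- The limit of the iterates of `WH` from `0`. -/
noncomputable def wfix [Finite V] (G : PCFG U V) (X : Set V) : G.ModFun := ⨆ k : ℕ, (WH X)^[k] 0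

/-! ### Unfolding equations, one for each kind of node. -/

section Unfold

variable [Finite V] (w : G.ModFun) (F : Weight U)

theorem wstep_self (hp : G.Postdom v v) : wstep X w v v hp F = F := by
  rw [wstep, dif_pos rfl]

theorem wstep_comp (hp : G.Postdom v v') (h1 : v' ≠ v) (h2 : v' ≠ G.fppd v) :
    wstep X w v v' hp F = wstep X w v (G.fppd v) (postdom_fppd v)
      (wstep X w (G.fppd v) v' (postdom_fppd_left hp h1 h2) F) := by
  rw [wstep, dif_neg h1, dif_pos h2]

theorem wstep_not_mem (hp : G.Postdom v v') (h1 : v' ≠ v) (h2 : v' = G.fppd v) (hv : v ∉ X) :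
    wstep X w v v' hp F = F := by
  rw [wstep, dif_neg h1, dif_neg (not_not.2 h2), if_pos hv]

variable (hp : G.Postdom v v') (h1 : v' ≠ v) (h2 : v' = G.fppd v) (hv : v ∈ X)
include h1 h2 hv

theorem wstep_skip {n : V} (hc : G.code v = .skip n) : wstep X w v v' hp F = F := by
  rw [wstep, dif_neg h1, dif_neg (not_not.2 h2), if_neg (not_not.2 hv)]
  split <;> simp_all

open Classical in
theorem wstep_assign {E : Expr U ℤ} {n : V} (hc : G.code v = .assign x E n) :
    wstep X w v v' hp F = fun s => F (Function.update s x (E.value s)) := by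
  rw [wstep, dif_neg h1, dif_neg (not_not.2 h2), if_neg (not_not.2 hv)]
  split <;> simp_all

open Classical in
theorem wstep_randAssign {ψ : PMF ℤ} {n : V} (hc : G.code v = .randAssign x ψ n) :
    wstep X w v v' hp F = fun s => ∑' n, ψ n * F (Function.update s x n) := by
  rw [wstep, dif_neg h1, dif_neg (not_not.2 h2), if_neg (not_not.2 hv)]
  split <;> simp_all

theorem wstep_observe {B : Expr U Bool} {n : V} (hc : G.code v = .observe B n) :
    wstep X w v v' hp F = fun s => if B.value s = true then F s else 0 := by
  rw [wstep, dif_neg h1, dif_neg (not_not.2 h2), if_neg (not_not.2 hv)]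
  split <;> simp_all

theorem wstep_branch {B : Expr U Bool} {t f : V} (hc : G.code v = .branch B t f)
    (ht : G.Postdom t v') (hf : G.Postdom f v') :
    wstep X w v v' hp F = fun s => if B.value s = true then wcall X w v v' t ht F s
      else wcall X w v v' f hf F s := by
  rw [wstep, dif_neg h1, dif_neg (not_not.2 h2), if_neg (not_not.2 hv)]
  split
  case h_5 B' t' f' hc' =>
    obtain ⟨rfl, rfl, rfl⟩ : B' = B ∧ t' = t ∧ f' = f := by
      rw [hc] at hc'
      simpa [eq_comm] using hc'
    simp only [wcall, dite_eq_ite]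
  all_goals simp_all

end Unfold

theorem postdom_branch (hp : G.Postdom v v') (h1 : v' ≠ v) {B : Expr U Bool} {t f : V}
    (hc : G.code v = .branch B t f) : G.Postdom t v' ∧ G.Postdom f v' :=
  ⟨postdom_succ hp h1 (by simp [hc, Instr.succs]), postdom_succ hp h1 (by simp [hc, Instr.succs])⟩

theorem code_ne_halt (hp : G.Postdom v v') (h1 : v' ≠ v) (r : Option U) :
    G.code v ≠ .halt r := fun hc =>
  ne_finish_of_postdom hp h1 ((G.isHalt_iff v).1 (by rw [hc]; trivial))

variable [Finite V]

theorem wstep_mono (X : Set V) {w w' : G.ModFun} (hw : w ≤ w') (hm : ∀ p, Monotone (w' p))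
    (v v' : V) (hp : G.Postdom v v') {F F' : Weight U} (hF : F ≤ F') :
    wstep X w v v' hp F ≤ wstep X w' v v' hp F' := by
  induction hn : G.LAP v v' using Nat.strong_induction_on generalizing v v' F F' with
  | _ n ih =>
    subst hn
    by_cases h1 : v' = v
    · subst h1
      simpa only [wstep_self] using hF
    by_cases h2 : v' = G.fppd v
    swap
    · rw [wstep_comp _ _ hp h1 h2, wstep_comp _ _ hp h1 h2]
      exact ih _ (LAP_fppd_lt hp h1 h2) _ _ _ (ih _ (LAP_fppd_left_lt hp h1 h2) _ _ _ hF rfl) rfl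
    by_cases hv : v ∈ X
    swap
    · simpa only [wstep_not_mem _ _ hp h1 h2 hv] using hF
    cases hc : G.code v with
    | skip => simpa only [wstep_skip _ _ hp h1 h2 hv hc] using hF
    | assign x E =>
      simp only [wstep_assign _ _ hp h1 h2 hv hc]
      exact fun s => hF _
    | randAssign x ψ =>
      simp only [wstep_randAssign _ _ hp h1 h2 hv hc]
      exact fun s => ENNReal.tsum_le_tsum fun n => mul_le_mul_right (hF _) _
    | observe B =>
      simp only [wstep_observe _ _ hp h1 h2 hv hc]
      intro s
      dsimp only
      split_ifs
      · exact hF s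
      · exact le_rfl
    | branch B t f =>
      obtain ⟨ht, hf⟩ := postdom_branch hp h1 hc
      have key : ∀ u hu, wcall X w v v' u hu F ≤ wcall X w' v v' u hu F' := by
        intro u hu
        unfold wcall
        split_ifs with hlt
        · exact ih _ hlt _ _ _ hF rfl
        · exact (hw _ F).trans (hm _ hF)
      simp only [wstep_branch _ _ hp h1 h2 hv hc ht hf]
      intro s
      dsimp only
      split_ifs
      · exact key t ht s
      · exact key f hf s
    | halt r => exact absurd hc (code_ne_halt hp h1 r)

theorem WH_mono (X : Set V) {w w' : G.ModFun} (hw : w ≤ w') (hm : ∀ p, Monotone (w' p)) :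
    WH X w ≤ WH X w' := fun p F => wstep_mono X hw hm _ _ p.2 (le_refl F)

theorem iterate_WH_monotone {w : G.ModFun} (hm : ∀ p, Monotone (w p)) (k : ℕ) (p : G.PD) :
    Monotone ((WH X)^[k] w p) := by
  induction k generalizing p with
  | zero => exact hm p
  | succ k ih =>
    rw [Function.iterate_succ_apply']
    exact fun F F' hF => wstep_mono X le_rfl ih _ _ p.2 hF

theorem iterate_WH_le {w w' : G.ModFun} (hw : w ≤ w') (hm : ∀ p, Monotone (w' p)) (k : ℕ) :
    (WH X)^[k] w ≤ (WH X)^[k] w' := by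
  induction k with
  | zero => exact hw
  | succ k ih =>
    simp only [Function.iterate_succ_apply']
    exact WH_mono X ih (iterate_WH_monotone hm k)

/-! ### Duality -/

/-- Integrating `h D` against a test function amounts to integrating `D` against its image
under `w`. -/
def Dual (h w : Weight U → Weight U) : Prop :=
  ∀ D F : Weight U, ∑' s, h D s * F s = ∑' s, D s * w F s

/-- Point masses recover the values of the adjoint. -/
theorem Dual.eq {h w w' : Weight U → Weight U} (hw : Dual h w) (hw' : Dual h w') : w = w' := by
  classical
  funext F s
  have := (hw (Pi.single s 1) F).symm.trans (hw' (Pi.single s 1) F)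
  rw [tsum_eq_single s, tsum_eq_single s] at this
  · simpa using this
  all_goals
    intro s' hs'
    simp [hs']

theorem dual_id : Dual (U := U) id id := fun _ _ => rfl

theorem dual_select (B : Expr U Bool) (b : Bool) :
    Dual (Weight.select B b) fun F s => if B.value s = b then F s else 0 := fun D F =>
  tsum_congr fun s => by by_cases h : B.value s = b <;> simp [Weight.select, h]

open Classical in
theorem dual_assign (x : U) (E : Expr U ℤ) :
    Dual (Weight.assign x E) fun F s => F (Function.update s x (E.value s)) := by
  intro D F
  simp only [Weight.assign, ← ENNReal.tsum_mul_right]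
  rw [ENNReal.tsum_comm]
  refine tsum_congr fun s => ?_
  rw [tsum_eq_single (Function.update s x (E.value s))]
  · simp
  · intro s' hs'
    simp [hs']

open Classical in
theorem dual_randAssign (x : U) (ψ : PMF ℤ) :
    Dual (Weight.randAssign x ψ) fun F s => ∑' n, ψ n * F (Function.update s x n) := by
  intro D F
  simp only [Weight.randAssign, ← ENNReal.tsum_mul_right, ← ENNReal.tsum_mul_left]
  rw [ENNReal.tsum_comm]
  refine tsum_congr fun s => ?_
  have hinj : Function.Injective fun n : ℤ => Function.update s x n :=
    Function.update_injective s x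
  -- Only stores that equal `s` off `x` contribute, and their value at `x` parametrizes them.
  rw [← hinj.tsum_eq]
  · refine tsum_congr fun n => ?_
    rw [if_pos fun y hy => Function.update_of_ne hy _ _, Function.update_self]
    ring
  · intro s' hs'
    refine ⟨s' x, ?_⟩
    by_cases h : ∀ y, y ≠ x → s' y = s y
    · funext y
      by_cases hy : y = x
      · subst hy; simp
      · simp [hy, h y hy]
    · simp [h] at hs'

theorem Dual.comp {h h' w w' : Weight U → Weight U} (H : Dual h w) (H' : Dual h' w') :
    Dual (fun D => h' (h D)) fun F => w (w' F) := fun D F => by rw [H', H]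

theorem dual_step {h w : G.ModFun} (H : ∀ p, Dual (h p) (w p)) (v v' : V)
    (hp : G.Postdom v v') : Dual (G.step X h v v' hp) (wstep X w v v' hp) := by
  induction hn : G.LAP v v' using Nat.strong_induction_on generalizing v v' with
  | _ n ih =>
    subst hn
    have e : ∀ {a b c d : Weight U → Weight U}, Dual a b → c = a → d = b → Dual c d := by
      rintro a b c d h rfl rfl
      exact h
    by_cases h1 : v' = v
    · subst h1
      refine e dual_id ?_ ?_ <;> funext D
      · rw [step, dif_pos rfl, id]
      · rw [wstep_self, id]
    by_cases h2 : v' = G.fppd v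
    swap
    · refine e ((ih _ (LAP_fppd_lt hp h1 h2) _ _ (postdom_fppd v) rfl).comp
        (ih _ (LAP_fppd_left_lt hp h1 h2) _ _ (postdom_fppd_left hp h1 h2) rfl)) ?_ ?_ <;> funext D
      · rw [step, dif_neg h1, dif_pos h2]
      · rw [wstep_comp _ _ hp h1 h2]
    by_cases hv : v ∈ X
    swap
    · refine e dual_id ?_ ?_ <;> funext D
      · rw [step, dif_neg h1, dif_neg (not_not.2 h2), if_pos hv, id]
      · rw [wstep_not_mem _ _ hp h1 h2 hv, id]
    have hs : ∀ D, G.step X h v v' hp D = G.step X h v v' hp D := fun _ => rfl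
    conv at hs =>
      enter [D, 2]
      rw [step, dif_neg h1, dif_neg (not_not.2 h2), if_neg (not_not.2 hv)]
    cases hc : G.code v with
    | skip n =>
      refine e dual_id ?_ ?_ <;> funext D
      · rw [hs]; split <;> simp_all
      · rw [wstep_skip _ _ hp h1 h2 hv hc, id]
    | assign x E n =>
      refine e (dual_assign x E) ?_ ?_ <;> funext D
      · rw [hs]; split <;> simp_all
      · rw [wstep_assign _ _ hp h1 h2 hv hc]
    | randAssign x ψ n =>
      refine e (dual_randAssign x ψ) ?_ ?_ <;> funext D
      · rw [hs]; split <;> simp_all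
      · rw [wstep_randAssign _ _ hp h1 h2 hv hc]
    | observe B n =>
      refine e (dual_select B true) ?_ ?_ <;> funext D
      · rw [hs]; split <;> simp_all
      · rw [wstep_observe _ _ hp h1 h2 hv hc]
    | branch B t f =>
      obtain ⟨ht, hf⟩ := postdom_branch hp h1 hc
      classical
      have key : ∀ u hu, Dual (fun D => if _hlt : G.LAP u v' < G.LAP v v' then
          G.step X h u v' hu D else h ⟨(u, v'), hu⟩ D) (wcall X w v v' u hu) := by
        intro u hu D F
        unfold wcall
        split_ifs with hlt
        · exact ih _ hlt _ _ _ rfl D F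
        · exact H _ D F
      intro D F
      have hs' : G.step X h v v' hp D =
          (if _hlt : G.LAP t v' < G.LAP v v' then G.step X h t v' ht (D.select B true)
            else h ⟨(t, v'), ht⟩ (D.select B true)) +
          (if _hlt : G.LAP f v' < G.LAP v v' then G.step X h f v' hf (D.select B false)
            else h ⟨(f, v'), hf⟩ (D.select B false)) := by
        rw [hs]
        split
        case h_5 B' t' f' hc' =>
          obtain ⟨rfl, rfl, rfl⟩ : B' = B ∧ t' = t ∧ f' = f := by
            rw [hc] at hc'
            simpa [eq_comm] using hc'
          rfl
        all_goals simp_all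
      rw [hs', wstep_branch _ _ hp h1 h2 hv hc ht hf]
      simp only [Pi.add_apply, add_mul]
      rw [ENNReal.tsum_add, key t ht, key f hf, dual_select, dual_select, ← ENNReal.tsum_add]
      refine tsum_congr fun s => ?_
      cases hB : B.value s <;> simp [hB]
    | halt r => exact absurd hc (code_ne_halt hp h1 r)

theorem dual_iterate (k : ℕ) (p : G.PD) :
    Dual ((G.HH X)^[k] 0 p) ((WH X)^[k] 0 p) := by
  induction k generalizing p with
  | zero => exact fun D F => by simp
  | succ k ih =>
    simp only [Function.iterate_succ_apply']
    exact dual_step ih _ _ p.2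

theorem monotone_iterate_WH {w : G.ModFun} (hw : w ≤ WH X w) (hm : ∀ p, Monotone (w p)) :
    Monotone fun k => (WH X)^[k] w := by
  refine monotone_nat_of_le_succ fun k => ?_
  rw [Function.iterate_succ_apply]
  induction k with
  | zero => exact hw
  | succ k ih =>
    simp only [Function.iterate_succ_apply'] at ih ⊢
    refine WH_mono X ih fun p => ?_
    have := iterate_WH_monotone (X := X) hm (k + 1) p
    rwa [Function.iterate_succ_apply] at this

/-- Monotone convergence, applied to both sides of the duality of the iterates. -/
theorem dual_fix (p : G.PD) : Dual (G.fix X p) (wfix G X p) := by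
  intro D F
  have hm : Monotone fun k => (WH X)^[k] (0 : G.ModFun) :=
    monotone_iterate_WH (fun _ _ _ => zero_le) fun _ _ _ _ => le_rfl
  simp only [fix, wfix, iSup_apply, ENNReal.iSup_mul, ENNReal.mul_iSup]
  rw [tsum_iSup_chain, tsum_iSup_chain]
  · exact iSup_congr fun k => dual_iterate k p D F
  · exact fun i j hij s => mul_le_mul_right (hm hij p F s) _
  · exact fun i j hij s => mul_le_mul_left (iterate_mono X hij p D s) _

/-- Both sides are adjoint to `G.fix X`, itself a fixed point, so uniqueness of adjoints spares a
continuity argument for `WH`. -/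
theorem WH_wfix (X : Set V) : WH X (wfix G X) = wfix G X := by
  funext p
  refine Dual.eq ?_ (dual_fix p)
  have := dual_step (X := X) (h := G.fix X) dual_fix _ _ p.2
  rwa [← (isLeast_fix (G := G) X).1.2]

theorem monotone_wfix (p : G.PD) : Monotone (wfix G X p) := by
  intro F F' hF
  simp only [wfix, iSup_apply]
  exact iSup_mono fun k => iterate_WH_monotone (fun _ _ _ _ => le_rfl) k p hF

/-- The iterates of `w` lie between those of `0` and those of the fixed point `wfix G X`, which are
constant. This permits a change of starting point. -/
theorem iSup_iterate_WH {w : G.ModFun} (hw : w ≤ wfix G X) (hm : ∀ p, Monotone (w p)) :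
    ⨆ k : ℕ, (WH X)^[k] w = wfix G X := by
  refine le_antisymm (iSup_le fun k => ?_)
    (iSup_mono fun k => iterate_WH_le (fun _ _ _ => zero_le) hm k)
  refine (iterate_WH_le hw monotone_wfix k).trans_eq ?_
  exact Function.iterate_fixed (WH_wfix X) k

end PCFG

namespace PCFG

variable {U V : Type*} {G : PCFG U V} {Q Q₀ : Set V} {v v' u : V} {x : U}

/-! ### Factorisation of the original program into its slices -/

theorem apply_update_of_dependsOn {β : Type*} {g : Store U → β} {R : Set U} [DecidableEq U]
    (hg : DependsOn g R) (hx : x ∉ R) (s : Store U) (n : ℤ) :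
    g (Function.update s x n) = g s :=
  hg fun y hy => Function.update_of_ne (by rintro rfl; exact hx hy) _ _

theorem expr_value_congr {α : Type*} (E : Expr U α) {s s' : Store U}
    (h : ∀ y ∈ E.fv, s y = s' y) : E.value s = E.value s' :=
  congrArg E.eval (funext fun y => h y y.2)

/-- The properties of transformers of test functions that hold for programs sliced to `Q`. -/
structure IsSliced (Q : Set V) (a : G.ModFun) : Prop where
  eq_self : ∀ {v v'} (hp : G.Postdom v v') F, G.Avoids v Q v' → a ⟨(v, v'), hp⟩ F = F
  dependsOn : ∀ {v v'} (hp : G.Postdom v v') F, DependsOn F (G.rv Q v') →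
    DependsOn (a ⟨(v, v'), hp⟩ F) (G.rv Q v)

open Classical in
/-- The restriction of `w` to the pairs `(v, v')` such that `v` avoids `P` until `v'`. -/
noncomputable def restrictAvoids (P : Set V) (w : G.ModFun) : G.ModFun :=
  fun p F => if G.Avoids p.1.1 P p.1.2 then w p F else 0

theorem restrictAvoids_le (P : Set V) (w : G.ModFun) : restrictAvoids P w ≤ w := by
  intro p F
  unfold restrictAvoids
  split_ifs
  · exact le_rfl
  · exact fun _ => zero_le

theorem monotone_restrictAvoids (P : Set V) {w : G.ModFun} (hw : ∀ p, Monotone (w p))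
    (p : G.PD) : Monotone (restrictAvoids P w p) := by
  intro F F' hF
  unfold restrictAvoids
  split_ifs
  · exact hw p hF
  · exact le_rfl

/-- The semantics of the program sliced to `Q` on the pairs where it is the identity. -/
noncomputable def sliceInit (G : PCFG U V) (Q : Set V) : G.ModFun :=
  restrictAvoids Q fun _ F => F

theorem isSliced_sliceInit (hQ : G.WeakSliceSet Q) : IsSliced Q (sliceInit G Q) := by
  refine ⟨fun hp F h => if_pos h, fun {v v'} hp F hF => ?_⟩
  unfold sliceInit restrictAvoids
  split_ifs with h
  · exact hF.mono (Avoids.rv_subset h hQ.2 hp)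
  · exact fun _ _ _ => rfl

theorem monotone_sliceInit (p : G.PD) : Monotone (sliceInit G Q p) :=
  monotone_restrictAvoids Q (fun _ _ _ h => h) p

variable [Finite V]

/-- No node of `Q` is executed on the way, so `w` is never consulted and may be arbitrary. -/
theorem wstep_of_avoids (w : G.ModFun) (hp : G.Postdom v v') (h : G.Avoids v Q v')
    (F : Weight U) : wstep Q w v v' hp F = F := by
  induction hn : G.LAP v v' using Nat.strong_induction_on generalizing v v' F with
  | _ n ih =>
    subst hn
    by_cases h1 : v' = v
    · subst h1
      exact wstep_self _ _ _
    by_cases h2 : v' = G.fppd v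
    · exact wstep_not_mem _ _ hp h1 h2 (h.not_mem h1)
    · rw [wstep_comp _ _ hp h1 h2, ih _ (LAP_fppd_lt hp h1 h2) _ (h.fppd hp h1) _ rfl,
        ih _ (LAP_fppd_left_lt hp h1 h2) _ (h.fppd_left hp h1 h2) _ rfl]

/-- Needed for compositions: the intermediate test function must again depend on relevant variables
only. -/
theorem wstep_dependsOn (hQ : G.WeakSliceSet Q) {a : G.ModFun} (ha : IsSliced Q a)
    (hp : G.Postdom v v') {F : Weight U} (hF : DependsOn F (G.rv Q v')) :
    DependsOn (wstep Q a v v' hp F) (G.rv Q v) := by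
  classical
  induction hn : G.LAP v v' using Nat.strong_induction_on generalizing v v' F with
  | _ n ih =>
    subst hn
    by_cases h1 : v' = v
    · subst h1
      rwa [wstep_self]
    by_cases h2 : v' = G.fppd v
    swap
    · rw [wstep_comp _ _ hp h1 h2]
      exact ih _ (LAP_fppd_lt hp h1 h2) _ (ih _ (LAP_fppd_left_lt hp h1 h2) _ hF rfl) rfl
    by_cases hv : v ∈ Q
    swap
    · rw [wstep_not_mem _ _ hp h1 h2 hv]
      have := hQ.avoids_fppd hv (ne_finish_of_postdom hp h1)
      rw [← h2] at this
      exact hF.mono (this.rv_subset hQ.2 hp)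
    have huse := uses_subset_rv (G := G) hv
    have hdef : ∀ {n : V}, (G.code v).succs = {n} → ∀ y ∈ G.rv Q v', y ∉ (G.code v).defs →
        y ∈ G.rv Q v := by
      intro n hs y hy hd
      rw [h2, fppd_eq_of_succs hs] at hy
      exact mem_rv_of_succ (by simp [hs]) hy hd
    have hrv : ∀ {u : V}, u ∈ (G.code v).succs → (G.code v).defs = ∅ →
        G.rv Q u ⊆ G.rv Q v := fun hu hd y hy => mem_rv_of_succ hu hy (by simp [hd])
    cases hc : G.code v with
    | skip n =>
      rw [wstep_skip _ _ hp h1 h2 hv hc]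
      refine hF.mono fun y hy => hdef (n := n) ?_ y hy ?_ <;> simp [hc, Instr.succs, Instr.defs]
    | assign x E n =>
      rw [wstep_assign _ _ hp h1 h2 hv hc]
      intro s s' hs
      refine hF fun y hy => ?_
      by_cases hyx : y = x
      · subst hyx
        simp only [Function.update_self]
        exact expr_value_congr E fun z hz => hs z (huse (by simpa [hc, Instr.uses] using hz))
      · rw [Function.update_of_ne hyx, Function.update_of_ne hyx]
        refine hs y (hdef (n := n) ?_ y hy ?_) <;> simp [hc, Instr.succs, Instr.defs, hyx]
    | randAssign x ψ n =>
      rw [wstep_randAssign _ _ hp h1 h2 hv hc]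
      intro s s' hs
      refine tsum_congr fun m => congrArg _ (hF fun y hy => ?_)
      by_cases hyx : y = x
      · subst hyx
        simp only [Function.update_self]
      · rw [Function.update_of_ne hyx, Function.update_of_ne hyx]
        refine hs y (hdef (n := n) ?_ y hy ?_) <;> simp [hc, Instr.succs, Instr.defs, hyx]
    | observe B n =>
      rw [wstep_observe _ _ hp h1 h2 hv hc]
      intro s s' hs
      have hB := expr_value_congr B fun z hz => hs z (huse (by simpa [hc, Instr.uses] using hz))
      have : F s = F s' := hF fun y hy => hs y <| by
        refine hdef (n := n) ?_ y hy ?_ <;> simp [hc, Instr.succs, Instr.defs]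
      simp only [hB, this]
    | branch B t f =>
      obtain ⟨ht, hf⟩ := postdom_branch hp h1 hc
      have key : ∀ u hu, DependsOn (wcall Q a v v' u hu F) (G.rv Q u) := by
        intro u hu
        unfold wcall
        split_ifs with hlt
        · exact ih _ hlt _ hF rfl
        · exact ha.dependsOn _ _ hF
      rw [wstep_branch _ _ hp h1 h2 hv hc ht hf]
      intro s s' hs
      have hB := expr_value_congr B fun z hz => hs z (huse (by simpa [hc, Instr.uses] using hz))
      have e1 := key t ht fun y hy => hs y
        (hrv (by simp [hc, Instr.succs]) (by simp [hc, Instr.defs]) hy)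
      have e2 := key f hf fun y hy => hs y
        (hrv (by simp [hc, Instr.succs]) (by simp [hc, Instr.defs]) hy)
      simp only [hB, e1, e2]
    | halt r => exact absurd hc (code_ne_halt hp h1 r)

theorem IsSliced.WH (hQ : G.WeakSliceSet Q) {a : G.ModFun} (ha : IsSliced Q a) :
    IsSliced Q (WH Q a) :=
  ⟨fun hp F h => wstep_of_avoids a hp h F, fun hp _ hF => wstep_dependsOn hQ ha hp hF⟩

theorem IsSliced.iterate (hQ : G.WeakSliceSet Q) {a : G.ModFun} (ha : IsSliced Q a) (k : ℕ) :
    IsSliced Q ((PCFG.WH Q)^[k] a) := by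
  induction k with
  | zero => exact ha
  | succ k ih =>
    rw [Function.iterate_succ_apply']
    exact ih.WH hQ

/-- Since `v ∉ Q₀`, nothing defined at `v` affects `g`, which passes through as a constant factor.
If also `v ∉ Q`, then `v` is invisible to `f` too: an assignment changes neither factor, a random
choice has total mass `1`, and both branches return `f * g`. -/
theorem wstep_mul_of_not_mem (hQ : G.WeakSliceSet Q) (hQ₀ : G.WeakSliceSet Q₀) {h a : G.ModFun}
    (ha : IsSliced Q a) (hp : G.Postdom v v') (h1 : v' ≠ v) (h2 : v' = G.fppd v)
    (hv₀ : v ∉ Q₀) (hobs : (G.code v).IsObserve → v ∈ Q) {f g : Weight U}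
    (hf : DependsOn f (G.rv Q v')) (hg : DependsOn g (G.rv Q₀ v'))
    (hcall : ∀ u ∈ (G.code v).succs, ∀ hu,
      wcall Set.univ h v v' u hu (f * g) = wcall Q a v v' u hu f * g) :
    wstep Set.univ h v v' hp (f * g) = wstep Q a v v' hp f * g := by
  classical
  have hend := ne_finish_of_postdom hp h1
  have hav₀ : G.Avoids v Q₀ v' := h2 ▸ hQ₀.avoids_fppd hv₀ hend
  have hg' : ∀ {x : U}, x ∈ (G.code v).defs → x ∉ G.rv Q₀ v' := fun hx =>
    hav₀.not_mem_defs hQ₀.2 hp h1 hx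
  by_cases hv : v ∈ Q
  · cases hc : G.code v with
    | skip n => rw [wstep_skip _ _ hp h1 h2 (Set.mem_univ v) hc, wstep_skip _ _ hp h1 h2 hv hc]
    | assign x E n =>
      rw [wstep_assign _ _ hp h1 h2 (Set.mem_univ v) hc, wstep_assign _ _ hp h1 h2 hv hc]
      have hx : x ∉ G.rv Q₀ v' := hg' (by simp [hc, Instr.defs])
      funext s
      simp only [Pi.mul_apply, apply_update_of_dependsOn hg hx]
    | randAssign x ψ n =>
      rw [wstep_randAssign _ _ hp h1 h2 (Set.mem_univ v) hc, wstep_randAssign _ _ hp h1 h2 hv hc]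
      have hx : x ∉ G.rv Q₀ v' := hg' (by simp [hc, Instr.defs])
      funext s
      simp only [Pi.mul_apply, apply_update_of_dependsOn hg hx, ← mul_assoc, ENNReal.tsum_mul_right]
    | observe B n =>
      rw [wstep_observe _ _ hp h1 h2 (Set.mem_univ v) hc, wstep_observe _ _ hp h1 h2 hv hc]
      funext s
      simp only [Pi.mul_apply, ite_mul, zero_mul]
    | branch B t f' =>
      obtain ⟨ht, hf'⟩ := postdom_branch hp h1 hc
      rw [wstep_branch _ _ hp h1 h2 (Set.mem_univ v) hc ht hf', wstep_branch _ _ hp h1 h2 hv hc ht hf',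
        hcall t (by simp [hc, Instr.succs]) ht, hcall f' (by simp [hc, Instr.succs]) hf']
      funext s
      simp only [Pi.mul_apply, ite_mul]
    | halt r => exact absurd hc (code_ne_halt hp h1 r)
  · have hav : G.Avoids v Q v' := h2 ▸ hQ.avoids_fppd hv hend
    have hf' : ∀ {x : U}, x ∈ (G.code v).defs → x ∉ G.rv Q v' := fun hx =>
      hav.not_mem_defs hQ.2 hp h1 hx
    rw [wstep_not_mem a f hp h1 h2 hv]
    cases hc : G.code v with
    | skip n => rw [wstep_skip _ _ hp h1 h2 (Set.mem_univ v) hc]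
    | assign x E n =>
      rw [wstep_assign _ _ hp h1 h2 (Set.mem_univ v) hc]
      have hx : x ∉ G.rv Q₀ v' := hg' (by simp [hc, Instr.defs])
      have hx' : x ∉ G.rv Q v' := hf' (by simp [hc, Instr.defs])
      funext s
      simp only [Pi.mul_apply, apply_update_of_dependsOn hg hx, apply_update_of_dependsOn hf hx']
    | randAssign x ψ n =>
      rw [wstep_randAssign _ _ hp h1 h2 (Set.mem_univ v) hc]
      have hx : x ∉ G.rv Q₀ v' := hg' (by simp [hc, Instr.defs])
      have hx' : x ∉ G.rv Q v' := hf' (by simp [hc, Instr.defs])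
      funext s
      simp only [Pi.mul_apply, apply_update_of_dependsOn hg hx, apply_update_of_dependsOn hf hx',
        ENNReal.tsum_mul_right, PMF.tsum_coe, one_mul]
    | observe B n => exact absurd (hobs (by rw [hc]; trivial)) hv
    | branch B t f' =>
      obtain ⟨ht, hf'⟩ := postdom_branch hp h1 hc
      have key : ∀ u ∈ (G.code v).succs, ∀ hu, wcall Set.univ h v v' u hu (f * g) = f * g := by
        intro u hus hu
        rw [hcall u hus hu]
        congr 1
        unfold wcall
        split_ifs
        · exact wstep_of_avoids _ hu (hav.succ h1 hus) f
        · exact ha.eq_self hu f (hav.succ h1 hus)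
      rw [wstep_branch _ _ hp h1 h2 (Set.mem_univ v) hc ht hf',
        key t (by simp [hc, Instr.succs]) ht, key f' (by simp [hc, Instr.succs]) hf']
      simp only [ite_self]
    | halt r => exact absurd hc (code_ne_halt hp h1 r)

/-- On products of test functions in the `Q`-relevant and in the `Q₀`-relevant variables, `h` is
given by `a` and `b`. -/
def Factors (Q Q₀ : Set V) (h a b : G.ModFun) : Prop :=
  ∀ {v v'} (hp : G.Postdom v v') {f g : Weight U}, DependsOn f (G.rv Q v') →
    DependsOn g (G.rv Q₀ v') → h ⟨(v, v'), hp⟩ (f * g) = a ⟨(v, v'), hp⟩ f * b ⟨(v, v'), hp⟩ g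

/-- At a node outside one of the sets, the corresponding slice acts as the identity up to `G.fppd
v`, both at `v` and from its successors, so `wstep_mul_of_not_mem` covers every node. -/
theorem Factors.WH {h a b : G.ModFun} (H : Factors Q Q₀ h a b) (hQ : G.WeakSliceSet Q)
    (hQ₀ : G.WeakSliceSet Q₀) (hd : Disjoint Q Q₀)
    (hobs : ∀ v, (G.code v).IsObserve → v ∈ Q ∪ Q₀) (ha : IsSliced Q a) (hb : IsSliced Q₀ b) :
    Factors Q Q₀ (WH Set.univ h) (WH Q a) (WH Q₀ b) := by
  intro v v' hp f g hf hg
  change wstep Set.univ h v v' hp (f * g) = wstep Q a v v' hp f * wstep Q₀ b v v' hp g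
  induction hn : G.LAP v v' using Nat.strong_induction_on generalizing v v' f g with
  | _ n ih =>
    subst hn
    by_cases h1 : v' = v
    · subst h1
      simp only [wstep_self]
    by_cases h2 : v' = G.fppd v
    swap
    · simp only [wstep_comp _ _ hp h1 h2]
      rw [ih _ (LAP_fppd_left_lt hp h1 h2) _ hf hg rfl]
      exact ih _ (LAP_fppd_lt hp h1 h2) _ (wstep_dependsOn hQ ha _ hf)
        (wstep_dependsOn hQ₀ hb _ hg) rfl
    have hend := ne_finish_of_postdom hp h1
    have hcall : ∀ u hu, wcall Set.univ h v v' u hu (f * g) =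
        wcall Q a v v' u hu f * wcall Q₀ b v v' u hu g := by
      intro u hu
      unfold wcall
      split_ifs with hlt
      · exact ih _ hlt _ hf hg rfl
      · exact H _ hf hg
    have hself : ∀ {P : Set V} {c : G.ModFun}, IsSliced P c → G.Avoids v P v' →
        ∀ u ∈ (G.code v).succs, ∀ hu F, wcall P c v v' u hu F = F := by
      intro P c hc hav u hus hu F
      unfold wcall
      split_ifs
      · exact wstep_of_avoids _ hu (hav.succ h1 hus) F
      · exact hc.eq_self hu F (hav.succ h1 hus)
    -- By disjointness `v` is outside `Q` or outside `Q₀`; the first case is the second with the two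
    -- slices exchanged.
    by_cases hv₀ : v ∈ Q₀
    · have hv : v ∉ Q := fun hv => Set.disjoint_left.1 hd hv hv₀
      rw [wstep_not_mem a f hp h1 h2 hv, mul_comm f g, mul_comm f]
      refine wstep_mul_of_not_mem hQ₀ hQ hb hp h1 h2 hv (fun _ => hv₀) hg hf fun u hus hu => ?_
      rw [mul_comm g f, hcall, hself ha (h2 ▸ hQ.avoids_fppd hv hend) u hus, mul_comm]
    · rw [wstep_not_mem b g hp h1 h2 hv₀]
      refine wstep_mul_of_not_mem hQ hQ₀ ha hp h1 h2 hv₀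
        (fun ho => (hobs v ho).resolve_right hv₀) hf hg fun u hus hu => ?_
      rw [hcall, hself hb (h2 ▸ hQ₀.avoids_fppd hv₀ hend) u hus]

/-! ### Totality outside the slices -/

/-- Between `v` and `v'` no node defines a variable on which `F` depends, so `F` factors out. The
second factor `F'` is arbitrary because a composition turns it into an image under `wstep`. -/
theorem wstep_frame (hQ : G.WeakSliceSet Q) (hQ₀ : G.WeakSliceSet Q₀) {w : G.ModFun}
    (hw : ∀ {v v'} (hp : G.Postdom v v'), G.Avoids v Q v' → G.Avoids v Q₀ v' → ∀ {F : Weight U},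
      DependsOn F (G.rv Q v' ∪ G.rv Q₀ v') → ∀ F', w ⟨(v, v'), hp⟩ (F * F') =
        F * w ⟨(v, v'), hp⟩ F')
    (hp : G.Postdom v v') (hav : G.Avoids v Q v') (hav₀ : G.Avoids v Q₀ v') {F : Weight U}
    (hF : DependsOn F (G.rv Q v' ∪ G.rv Q₀ v')) (F' : Weight U) :
    wstep Set.univ w v v' hp (F * F') = F * wstep Set.univ w v v' hp F' := by
  classical
  induction hn : G.LAP v v' using Nat.strong_induction_on generalizing v v' F F' with
  | _ n ih =>
    subst hn
    by_cases h1 : v' = v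
    · subst h1
      simp only [wstep_self]
    by_cases h2 : v' = G.fppd v
    swap
    · have k := hav.fppd_left hp h1 h2
      have k₀ := hav₀.fppd_left hp h1 h2
      have hp' := postdom_fppd_left hp h1 h2
      rw [wstep_comp _ _ hp h1 h2, wstep_comp _ _ hp h1 h2,
        ih _ (LAP_fppd_left_lt hp h1 h2) _ k k₀ hF _ rfl]
      exact ih _ (LAP_fppd_lt hp h1 h2) _ (hav.fppd hp h1) (hav₀.fppd hp h1)
        (hF.mono (Set.union_subset_union (k.rv_subset hQ.2 hp') (k₀.rv_subset hQ₀.2 hp'))) _ rfl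
    have hx : ∀ {x : U}, x ∈ (G.code v).defs → x ∉ G.rv Q v' ∪ G.rv Q₀ v' := fun hx h =>
      h.elim (hav.not_mem_defs hQ.2 hp h1 hx) (hav₀.not_mem_defs hQ₀.2 hp h1 hx)
    cases hc : G.code v with
    | skip n => simp only [wstep_skip _ _ hp h1 h2 (Set.mem_univ v) hc]
    | assign x E n =>
      simp only [wstep_assign _ _ hp h1 h2 (Set.mem_univ v) hc]
      have hx : x ∉ G.rv Q v' ∪ G.rv Q₀ v' := hx (by simp [hc, Instr.defs])
      funext s
      simp only [Pi.mul_apply, apply_update_of_dependsOn hF hx]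
    | randAssign x ψ n =>
      simp only [wstep_randAssign _ _ hp h1 h2 (Set.mem_univ v) hc]
      have hx : x ∉ G.rv Q v' ∪ G.rv Q₀ v' := hx (by simp [hc, Instr.defs])
      funext s
      simp only [Pi.mul_apply, apply_update_of_dependsOn hF hx, mul_left_comm _ (F s),
        ENNReal.tsum_mul_left]
    | observe B n =>
      simp only [wstep_observe _ _ hp h1 h2 (Set.mem_univ v) hc]
      funext s
      simp only [Pi.mul_apply, mul_ite, mul_zero]
    | branch B t f =>
      obtain ⟨ht, hf⟩ := postdom_branch hp h1 hc
      have key : ∀ u ∈ (G.code v).succs, ∀ hu, wcall Set.univ w v v' u hu (F * F') =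
          F * wcall Set.univ w v v' u hu F' := by
        intro u hus hu
        unfold wcall
        split_ifs with hlt
        · exact ih _ hlt _ (hav.succ h1 hus) (hav₀.succ h1 hus) hF _ rfl
        · exact hw _ (hav.succ h1 hus) (hav₀.succ h1 hus) hF _
      rw [wstep_branch _ _ hp h1 h2 (Set.mem_univ v) hc ht hf, wstep_branch _ _ hp h1 h2 (Set.mem_univ v) hc ht hf,
        key t (by simp [hc, Instr.succs]) ht, key f (by simp [hc, Instr.succs]) hf]
      funext s
      simp only [Pi.mul_apply, mul_ite]
    | halt r => exact absurd hc (code_ne_halt hp h1 r)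

theorem wfix_frame (hQ : G.WeakSliceSet Q) (hQ₀ : G.WeakSliceSet Q₀) (hp : G.Postdom v v')
    (hav : G.Avoids v Q v') (hav₀ : G.Avoids v Q₀ v') {F : Weight U}
    (hF : DependsOn F (G.rv Q v' ∪ G.rv Q₀ v')) (F' : Weight U) :
    wfix G Set.univ ⟨(v, v'), hp⟩ (F * F') = F * wfix G Set.univ ⟨(v, v'), hp⟩ F' := by
  have key : ∀ k : ℕ, ∀ {v v'} (hp : G.Postdom v v'), G.Avoids v Q v' → G.Avoids v Q₀ v' →
      ∀ {F : Weight U}, DependsOn F (G.rv Q v' ∪ G.rv Q₀ v') → ∀ F',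
        (WH Set.univ)^[k] 0 ⟨(v, v'), hp⟩ (F * F') =
          F * (WH Set.univ)^[k] 0 ⟨(v, v'), hp⟩ F' := by
    intro k
    induction k with
    | zero => intros; simp
    | succ k ih =>
      intro v v' hp hav hav₀ F hF F'
      simp only [Function.iterate_succ_apply']
      exact wstep_frame hQ hQ₀ ih hp hav hav₀ hF F'
  funext s
  simp only [wfix, iSup_apply, key _ hp hav hav₀ hF, Pi.mul_apply, ENNReal.mul_iSup]

theorem wstep_wfix (X : Set V) (hp : G.Postdom v v') (F : Weight U) :
    wstep X (wfix G X) v v' hp F = wfix G X ⟨(v, v'), hp⟩ F :=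
  congrFun (congrFun (WH_wfix X) ⟨(v, v'), hp⟩) F

theorem wcall_wfix (X : Set V) (hu : G.Postdom u v') (F : Weight U) :
    wcall X (wfix G X) v v' u hu F = wfix G X ⟨(u, v'), hu⟩ F := by
  unfold wcall
  split_ifs
  · exact wstep_wfix X hu F
  · rfl

theorem Dual.apply_one {h w : Weight U → Weight U} (H : Dual h w) (hs : Weight.SumPreserving h) :
    w 1 = 1 := by
  classical
  funext s
  have hD : Weight.mass (Pi.single s 1 : Weight U) = 1 := by
    rw [Weight.mass, tsum_eq_single s]
    · simp
    · intro s' hs'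
      simp [hs']
  have h1 := H (Pi.single s 1) 1
  have h2 := hs (Pi.single s 1) (by rw [Weight.IsDistribution, hD]; simp)
  rw [hD] at h2
  simp only [Pi.one_apply, mul_one] at h1
  rw [Weight.mass, h1, tsum_eq_single s] at h2
  · simpa using h2
  · intro s' hs'
    simp [hs']

/-- Outside both slices no mass is lost. At a cycle-inducing node this is the assumption on slicing
pairs, transposed by `Dual.apply_one`; at any other node all successors have smaller `LAP`, so the
induction applies, and there are no `Observe` nodes. -/
theorem SlicingPair.wfix_one (hQ : G.SlicingPair Q Q₀) (hp : G.Postdom v v')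
    (hav : G.Avoids v Q v') (hav₀ : G.Avoids v Q₀ v') :
    wfix G Set.univ ⟨(v, v'), hp⟩ 1 = 1 := by
  induction hn : G.LAP v v' using Nat.strong_induction_on generalizing v v' with
  | _ n ih =>
    subst hn
    by_cases h1 : v' = v
    · subst h1
      rw [← wstep_wfix, wstep_self]
    by_cases h2 : v' = G.fppd v
    swap
    · rw [← wstep_wfix, wstep_comp _ _ hp h1 h2, wstep_wfix, wstep_wfix,
        ih _ (LAP_fppd_left_lt hp h1 h2) _ (hav.fppd_left hp h1 h2) (hav₀.fppd_left hp h1 h2) rfl,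
        ih _ (LAP_fppd_lt hp h1 h2) _ (hav.fppd hp h1) (hav₀.fppd hp h1) rfl]
    have hv : v ∉ Q ∪ Q₀ := fun h => h.elim (hav.not_mem h1) (hav₀.not_mem h1)
    by_cases hcyc : G.CycleInducing v
    · subst h2
      exact (dual_fix _).apply_one ((hQ.cycle v hcyc).resolve_left hv)
    have key : ∀ u ∈ (G.code v).succs, ∀ hu : G.Postdom u v',
        wfix G Set.univ ⟨(u, v'), hu⟩ 1 = 1 := fun u hus hu =>
      ih _ (h2 ▸ not_le.1 fun h => hcyc ⟨u, hus, h⟩) hu (hav.succ h1 hus) (hav₀.succ h1 hus) rfl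
    rw [← wstep_wfix]
    cases hc : G.code v with
    | skip n => simp only [wstep_skip _ _ hp h1 h2 (Set.mem_univ v) hc]
    | assign x E n =>
      simp only [wstep_assign _ _ hp h1 h2 (Set.mem_univ v) hc]
      rfl
    | randAssign x ψ n =>
      simp only [wstep_randAssign _ _ hp h1 h2 (Set.mem_univ v) hc, Pi.one_apply, mul_one, PMF.tsum_coe]
      rfl
    | observe B n => exact absurd (hQ.observe_mem v (by rw [hc]; trivial)) hv
    | branch B t f =>
      obtain ⟨ht, hf⟩ := postdom_branch hp h1 hc
      rw [wstep_branch _ _ hp h1 h2 (Set.mem_univ v) hc ht hf, wcall_wfix, wcall_wfix,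
        key t (by simp [hc, Instr.succs]) ht, key f (by simp [hc, Instr.succs]) hf]
      simp only [ite_self]
    | halt r => exact absurd hc (code_ne_halt hp h1 r)

/-! ### Passage to the limit -/

theorem sliceInit_le_WH (w : G.ModFun) : sliceInit G Q ≤ WH Q w := by
  intro p F
  unfold sliceInit restrictAvoids
  split_ifs with h
  · exact (wstep_of_avoids w p.2 h F).ge
  · exact fun _ => zero_le

theorem iSup_iterate_sliceInit : ⨆ k : ℕ, (WH Q)^[k] (sliceInit G Q) = wfix G Q :=
  iSup_iterate_WH ((sliceInit_le_WH _).trans_eq (WH_wfix Q)) monotone_sliceInit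

theorem dependsOn_wfix (hQ : G.WeakSliceSet Q) (hp : G.Postdom v v') {F : Weight U}
    (hF : DependsOn F (G.rv Q v')) : DependsOn (wfix G Q ⟨(v, v'), hp⟩ F) (G.rv Q v) := by
  rw [← iSup_iterate_sliceInit]
  intro s s' hs
  simp only [iSup_apply]
  exact iSup_congr fun k => ((isSliced_sliceInit hQ).iterate hQ k).dependsOn hp F hF hs

theorem wfix_of_avoids (hp : G.Postdom v v') (h : G.Avoids v Q v') (F : Weight U) :
    wfix G Q ⟨(v, v'), hp⟩ F = F := by
  rw [← wstep_wfix]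
  exact wstep_of_avoids _ hp h F

/-- The backward semantics of the original program is the product of those of the two slices. -/
theorem SlicingPair.factors (hQ : G.SlicingPair Q Q₀) :
    Factors Q Q₀ (wfix G Set.univ) (wfix G Q) (wfix G Q₀) := by
  -- Loops outside both slices receive their limit meaning from the outset, matching the slices,
  -- which skip them at once.
  set γ : G.ModFun := restrictAvoids Q (restrictAvoids Q₀ (wfix G Set.univ)) with hγ
  have hγm : ∀ p, Monotone (γ p) :=
    monotone_restrictAvoids Q (monotone_restrictAvoids Q₀ monotone_wfix)
  have h0 : Factors Q Q₀ γ (sliceInit G Q) (sliceInit G Q₀) := by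
    intro v v' hp f g hf hg
    simp only [hγ, sliceInit, restrictAvoids]
    split_ifs with h h'
    · have hfg : DependsOn (f * g) (G.rv Q v' ∪ G.rv Q₀ v') := fun s s' hs =>
        congrArg₂ (· * ·) (hf fun y hy => hs y (Or.inl hy)) (hg fun y hy => hs y (Or.inr hy))
      -- The frame property reduces the claim to the constant `1`, which totality preserves.
      have := wfix_frame hQ.weak hQ.weak₀ hp h h' hfg 1
      rwa [hQ.wfix_one hp h h', mul_one] at this
    all_goals simp
  have hk : ∀ k : ℕ, Factors Q Q₀ ((WH Set.univ)^[k] γ) ((WH Q)^[k] (sliceInit G Q))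
      ((WH Q₀)^[k] (sliceInit G Q₀)) := by
    intro k
    induction k with
    | zero => exact h0
    | succ k ih =>
      simp only [Function.iterate_succ_apply']
      exact ih.WH hQ.weak hQ.weak₀ hQ.disjoint hQ.observe_mem
        ((isSliced_sliceInit hQ.weak).iterate hQ.weak k)
        ((isSliced_sliceInit hQ.weak₀).iterate hQ.weak₀ k)
  intro v v' hp f g hf hg
  rw [← iSup_iterate_WH (w := γ) ((restrictAvoids_le _ _).trans (restrictAvoids_le _ _)) hγm,
    ← iSup_iterate_sliceInit (Q := Q), ← iSup_iterate_sliceInit (Q := Q₀)]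
  funext s
  simp only [iSup_apply, Pi.mul_apply]
  have hmono : ∀ (P : Set V) (F : Weight U),
      Monotone fun k => (WH P)^[k] (sliceInit G P) ⟨(v, v'), hp⟩ F s := fun P F i j hij =>
    monotone_iterate_WH (sliceInit_le_WH _) monotone_sliceInit hij _ F s
  simp only [hk _ hp hf hg, Pi.mul_apply, ENNReal.iSup_mul, ENNReal.mul_iSup]
  -- Both chains increase, so the product of their suprema is attained along the diagonal.
  refine le_antisymm (iSup_le fun k => le_iSup_of_le k (le_iSup_of_le k le_rfl))
    (iSup_le fun i => iSup_le fun j => le_iSup_of_le (max i j) ?_)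
  exact mul_le_mul' (hmono Q f (by simp)) (hmono Q₀ g (by simp))

/-! ### Adjoints preserve the bound `1`, whence `c ≤ 1`. -/

theorem wstep_le_one {X : Set V} {w : G.ModFun} (hw : ∀ p F, F ≤ 1 → w p F ≤ 1)
    (hp : G.Postdom v v') {F : Weight U} (hF : F ≤ 1) : wstep X w v v' hp F ≤ 1 := by
  induction hn : G.LAP v v' using Nat.strong_induction_on generalizing v v' F with
  | _ n ih =>
    subst hn
    by_cases h1 : v' = v
    · subst h1
      rwa [wstep_self]
    by_cases h2 : v' = G.fppd v
    swap
    · rw [wstep_comp _ _ hp h1 h2]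
      exact ih _ (LAP_fppd_lt hp h1 h2) _ (ih _ (LAP_fppd_left_lt hp h1 h2) _ hF rfl) rfl
    by_cases hv : v ∈ X
    swap
    · rwa [wstep_not_mem _ _ hp h1 h2 hv]
    cases hc : G.code v with
    | skip n => rwa [wstep_skip _ _ hp h1 h2 hv hc]
    | assign x E n =>
      rw [wstep_assign _ _ hp h1 h2 hv hc]
      exact fun s => hF _
    | randAssign x ψ n =>
      rw [wstep_randAssign _ _ hp h1 h2 hv hc]
      intro s
      refine (ENNReal.tsum_le_tsum fun n => mul_le_mul_right (hF _) _).trans ?_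
      simp [PMF.tsum_coe]
    | observe B n =>
      rw [wstep_observe _ _ hp h1 h2 hv hc]
      intro s
      dsimp only
      split_ifs
      · exact hF s
      · exact zero_le
    | branch B t f =>
      obtain ⟨ht, hf⟩ := postdom_branch hp h1 hc
      have key : ∀ u hu, wcall X w v v' u hu F ≤ 1 := by
        intro u hu
        unfold wcall
        split_ifs with hlt
        · exact ih _ hlt _ hF rfl
        · exact hw _ F hF
      rw [wstep_branch _ _ hp h1 h2 hv hc ht hf]
      intro s
      dsimp only
      split_ifs
      · exact key t ht s
      · exact key f hf s
    | halt r => exact absurd hc (code_ne_halt hp h1 r)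

theorem wfix_le_one (X : Set V) (p : G.PD) {F : Weight U} (hF : F ≤ 1) :
    wfix G X p F ≤ 1 := by
  have key : ∀ (k : ℕ) (p : G.PD) (F : Weight U), F ≤ 1 → (WH X)^[k] 0 p F ≤ 1 := by
    intro k
    induction k with
    | zero => exact fun _ _ _ _ => zero_le
    | succ k ih =>
      intro p F hF
      rw [Function.iterate_succ_apply']
      exact wstep_le_one ih p.2 hF
  simp only [wfix, iSup_apply]
  exact iSup_le fun k => key k p F hF

end PCFG

/-! ### Marginals and independence -/

namespace Weight

variable {U : Type*} {D : Weight U} {R R₁ R₂ : Set U}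

theorem marginal_smul (c : ℝ≥0∞) (D : Weight U) (s : StoreOn R) :
    (c • D).marginal s = c * D.marginal s := by
  simp only [marginal, ← ENNReal.tsum_mul_left, Pi.smul_apply, smul_eq_mul, mul_ite, mul_zero]

theorem tsum_mul_domRestrict (D : Weight U) (A : StoreOn R → ℝ≥0∞) :
    ∑' s, D s * A (fun x => s x) = ∑' s₁ : StoreOn R, D.marginal s₁ * A s₁ := by
  classical
  simp only [marginal, ← ENNReal.tsum_mul_right]
  rw [ENNReal.tsum_comm]
  refine tsum_congr fun s => ?_
  rw [tsum_eq_single fun x : R => s x]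
  · simp
  · intro s₁ hs₁
    rw [if_neg fun h => hs₁ (funext fun x => (h x).symm), zero_mul]

theorem tsum_mul_domRestrict₂ (hd : Disjoint R₁ R₂) (D : Weight U)
    (A : StoreOn R₁ → ℝ≥0∞) (B : StoreOn R₂ → ℝ≥0∞) :
    ∑' s, D s * (A (fun x => s x) * B (fun x => s x)) =
      ∑' (s₁ : StoreOn R₁) (s₂ : StoreOn R₂), D.marginal (joinStore s₁ s₂) * (A s₁ * B s₂) := by
  classical
  have hj : ∀ (s₀ : Store U) (s₁ : StoreOn R₁) (s₂ : StoreOn R₂),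
      (∀ x : ↑(R₁ ∪ R₂), s₀ x = joinStore s₁ s₂ x) ↔
        (fun x : R₁ => s₀ x) = s₁ ∧ (fun x : R₂ => s₀ x) = s₂ := by
    intro s₀ s₁ s₂
    constructor
    · intro h
      refine ⟨funext fun x => ?_, funext fun x => ?_⟩
      · simpa [joinStore] using h ⟨x, Or.inl x.2⟩
      · simpa [joinStore, Set.disjoint_right.1 hd x.2] using h ⟨x, Or.inr x.2⟩
    · rintro ⟨rfl, rfl⟩ x
      simp [joinStore]
  simp only [marginal, hj, ← ENNReal.tsum_mul_right]
  refine Eq.trans ?_ (tsum_congr fun s₁ => ENNReal.tsum_comm)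
  refine Eq.trans ?_ ENNReal.tsum_comm
  refine tsum_congr fun s => ?_
  rw [tsum_eq_single fun x : R₁ => s x, tsum_eq_single fun x : R₂ => s x]
  · simp
  · intro s₂ hs₂
    simp [hs₂.symm]
  · intro s₁ hs₁
    simp [hs₁.symm]

theorem exists_eq_domRestrict {A : Weight U} (hA : DependsOn A R) :
    ∃ A' : StoreOn R → ℝ≥0∞, ∀ s, A s = A' fun x => s x := by
  classical
  exact ⟨fun s₁ => A fun x => if h : x ∈ R then s₁ ⟨x, h⟩ else 0,
    fun s => hA fun y hy => by simp [hy]⟩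

/-- Independence is the case of indicators of partial stores; summing over the values of `A` and `B`
on partial stores gives the general case. -/
theorem Independent.tsum_mul (h : D.Independent R₁ R₂) (hd : Disjoint R₁ R₂) {A B : Weight U}
    (hA : DependsOn A R₁) (hB : DependsOn B R₂) :
    (∑' s, D s * (A s * B s)) * D.mass = (∑' s, D s * A s) * ∑' s, D s * B s := by
  obtain ⟨A', hA'⟩ := exists_eq_domRestrict hA
  obtain ⟨B', hB'⟩ := exists_eq_domRestrict hB
  simp only [hA', hB', tsum_mul_domRestrict, tsum_mul_domRestrict₂ hd,
    ← ENNReal.tsum_mul_right]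
  refine tsum_congr fun s₁ => ?_
  rw [← ENNReal.tsum_mul_left]
  refine tsum_congr fun s₂ => ?_
  rw [mul_right_comm, h s₁ s₂]
  ring

end Weight

/-! ### The slicing theorem. -/

theorem mainTheorem1 {U V : Type*} [Finite U] [Finite V] (G : PCFG U V) (Q Q₀ : Set V)
    (hQ : G.SlicingPair Q Q₀) (v v' : V) (hPD : G.Postdom v v')
    (D : Weight U) (hD : D.IsDistribution)
    (hind : D.Independent (G.rv Q v) (G.rv Q₀ v)) :
    ∃ c : ℝ≥0, c ≤ 1 ∧
      (G.omega ⟨(v, v'), hPD⟩ D).AgreeOn ((c : ℝ≥0∞) • G.fix Q ⟨(v, v'), hPD⟩ D) (G.rv Q v') ∧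
      (G.StaysOutside v Q₀ v' → c = 1) := by
  classical
  -- By duality, `B s` is the mass that the `Q₀`-slice keeps when started from the point mass at
  -- `s`.
  set B : Weight U := PCFG.wfix G Q₀ ⟨(v, v'), hPD⟩ 1
  have hB : DependsOn B (G.rv Q₀ v) := PCFG.dependsOn_wfix hQ.weak₀ hPD fun _ _ _ => rfl
  have hm : ∀ (E : Weight U) (s : StoreOn (G.rv Q v')),
      E.marginal s = ∑' s₀, E s₀ * if ∀ x : G.rv Q v', s₀ x = s x then 1 else 0 := fun E s => by
    simp only [Weight.marginal, mul_ite, mul_one, mul_zero]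
  have key : ∀ s : StoreOn (G.rv Q v'), (G.omega ⟨(v, v'), hPD⟩ D).marginal s * D.mass =
      (G.fix Q ⟨(v, v'), hPD⟩ D).marginal s * ∑' s, D s * B s := by
    intro s
    set F : Weight U := fun s₀ => if ∀ x : G.rv Q v', s₀ x = s x then 1 else 0 with hF
    have hFd : DependsOn F (G.rv Q v') := by
      intro s₁ s₂ h
      simp only [hF]
      congr 1
      exact propext (forall_congr' fun x => by rw [h x x.2])
    have hfac := hQ.factors hPD hFd (g := 1) fun _ _ _ => rfl
    rw [mul_one] at hfac
    rw [hm, hm, PCFG.omega, PCFG.dual_fix _ D F, PCFG.dual_fix _ D F, hfac]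
    exact hind.tsum_mul (PCFG.disjoint_rv hQ.weak.2 hQ.weak₀.2 hQ.disjoint v)
      (PCFG.dependsOn_wfix hQ.weak hPD hFd) hB
  have hle : ∑' s, D s * B s ≤ D.mass := by
    refine ENNReal.tsum_le_tsum fun s => ?_
    exact mul_le_of_le_one_right' (PCFG.wfix_le_one Q₀ _ le_rfl s)
  -- Here the quotient defining `c` would be `0 / 0 = 0`, which violates the clause `c = 1`; as all
  -- marginals vanish, `1` serves.
  by_cases h0 : D.mass = 0
  · refine ⟨1, le_rfl, fun s => ?_, fun _ => rfl⟩
    have hD0 : ∀ s, D s = 0 := ENNReal.tsum_eq_zero.1 h0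
    rw [Weight.marginal_smul, hm, hm, PCFG.omega, PCFG.dual_fix _ D, PCFG.dual_fix _ D]
    simp [hD0]
  have hc1 : (∑' s, D s * B s) / D.mass ≤ 1 := ENNReal.div_le_of_le_mul (by rwa [one_mul])
  have hc : (((∑' s, D s * B s) / D.mass).toNNReal : ℝ≥0∞) = (∑' s, D s * B s) / D.mass :=
    ENNReal.coe_toNNReal (ne_top_of_le_ne_top ENNReal.one_ne_top hc1)
  refine ⟨((∑' s, D s * B s) / D.mass).toNNReal, ?_, fun s => ?_, fun hs => ?_⟩
  · rwa [← ENNReal.coe_le_coe, hc, ENNReal.coe_one]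
  · rw [Weight.marginal_smul, hc, mul_comm, ← mul_div_assoc, ENNReal.eq_div_iff h0 hD, mul_comm]
    exact key s
  · have hB1 : B = 1 := PCFG.wfix_of_avoids hPD (hs.avoids hPD) 1
    rw [← ENNReal.coe_inj, hc, hB1]
    simp only [Pi.one_apply, mul_one]
    exact ENNReal.div_self h0 hD
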